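/- Let $\mathbb{B}=\{0,1\mid 1+1=1\}$ be the Boolean semiring and let $\Sigma$ be an alphabet. A Büchi quasi-automaton $(P)=(P,\{m_a\}_{a\in\Sigma},q_{\mathsf{in}},b)$ consists of a finitely generated projective $\mathbb{B}$-semimodule $P$ (a retract of some $\mathbb{B}^n$), $\mathbb{B}$-linear endomorphisms $m_a:P\to P$ for $a\in\Sigma$, a vector $q_{\mathsf{in}}\in P$ and a covector $b\in P^{*}=\mathrm{Hom}_{\mathbb{B}}(P,\mathbb{B})$. For $x\in P$ and a finite word $w=a_1\cdots a_n$ put $xw=m_{a_n}\cdots m_{a_1}(x)$ and $m_w(x)=xw$. For a right-infinite word $\omega=a_1a_2\cdots$ put $\gamma_\omega(x)=1$ if $b(xa_1\cdots a_n)=1$ for infinitely many $n>0$, and $\gamma_\omega(x)=0$ otherwise. The language of $(P)$ is $L_{(P)}=\{\omega : \gamma_\omega(q_{\mathsf{in}})=1\}$. Let $\mathrm{Cob}^{\mathsf{h}}_{\Sigma}$ be the symmetric monoidal category whose objects are oriented $0$-manifolds (finite sets of points with signs $\pm$) and whose morphisms are homeomorphism classes rel boundary of compact oriented one-dimensional cobordisms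 which may also have inner endpoints (endpoints not on the source or target) and which carry defects, i.e. interior points labelled by elements of $\Sigma$: towards every inner endpoint oriented out of the cobordism an infinite sequence of defects accumulates, so that the component ending there carries a right-infinite word; there is no other accumulation of defects, so that every other component carries a finite word (circular, if the component is a circle). Composition is gluing and the tensor product is disjoint union. Then $(P)$ determines a Boolean TQFT, i.e. there is a symmetric monoidal functor $$\mathcal{F}_{(P)}:\mathrm{Cob}^{\mathsf{h}}_{\Sigma}\longrightarrow\mathbb{B}\text{-pmod}$$ to the category of projective $\mathbb{B}$-semimodules, with isomorphisms $\mathcal{F}(+)\cong P$ and $\mathcal{F}(-)\cong P^{*}$ under which 1. the arc from $+$ to $+$ with a finite word $w$ goes to $m_w:P\to P$; 2. the half-interval from an inner endpoint to $+$ with a finite word $w$ goes to the map $\mathbb{B}\to P$, $1\mapsto q_{\mathsf{in}}w$; 3. the half-interval from $+$ to an inner endpoint with a right-infinite word $\omega$ goes to $\gamma_\omega:P\to\mathbb{B}$; 4. the cap $-+\,\to\emptyset$ goes to the evaluation $P^{*}\otimes P\to\mathbb{B}$, and the cup $\emptyset\to+-$ goes to the coevaluation $\mathbb{B}\to P\otimes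 P^{*}$, whose value at $1$ is the element that corresponds to $\mathrm{id}_P$ under $P\otimes P^{*}\to\mathrm{End}(P)$; 5. the floating interval with a right-infinite word $\omega$ evaluates to $1$ if and only if $\omega\in L_{(P)}$; 6. the floating circle with a word $w$ evaluates to the trace of $m_w$, i.e. to $\sum_i f_i(x_i)$ whenever $m_w(x)=\sum_i f_i(x)\,x_i$ for all $x\in P$, with $f_i\in P^{*}$ and $x_i\in P$. -/

import Mathlib

open CategoryTheory MonoidalCategory TensorProduct

universe u

/-! ## The Boolean semiring and projective semimodules over it -/

/-- The Boolean semiring `𝔹 = {0, 1 | 1 + 1 = 1}`. -/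
inductive BoolSR : Type
  | zero
  | one
  deriving DecidableEq

namespace BoolSR

instance : Zero BoolSR := ⟨zero⟩

instance : One BoolSR := ⟨one⟩

/-- Boolean addition ("or"). -/
def add : BoolSR → BoolSR → BoolSR
  | zero, y => y
  | one, _ => one

/-- Boolean multiplication ("and"). -/
def mul : BoolSR → BoolSR → BoolSR
  | zero, _ => zero
  | one, y => y

instance : Add BoolSR := ⟨add⟩

instance : Mul BoolSR := ⟨mul⟩

instance : CommSemiring BoolSR where
  add_assoc := by rintro (_ | _) (_ | _) (_ | _) <;> rfl
  zero_add := by rintro (_ | _) <;> rfl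
  add_zero := by rintro (_ | _) <;> rfl
  add_comm := by rintro (_ | _) (_ | _) <;> rfl
  mul_assoc := by rintro (_ | _) (_ | _) (_ | _) <;> rfl
  one_mul := by rintro (_ | _) <;> rfl
  mul_one := by rintro (_ | _) <;> rfl
  zero_mul := by rintro (_ | _) <;> rfl
  mul_zero := by rintro (_ | _) <;> rfl
  mul_comm := by rintro (_ | _) (_ | _) <;> rfl
  left_distrib := by rintro (_ | _) (_ | _) (_ | _) <;> rfl
  right_distrib := by rintro (_ | _) (_ | _) (_ | _) <;> rfl
  nsmul := nsmulRec
  npow := npowRec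

end BoolSR

/-- The property of being a projective `𝔹`-semimodule, i.e. a retract of a free one. -/
def isProjectiveSemimodule : ObjectProperty (SemimoduleCat.{0} BoolSR) :=
  fun M => Module.Projective BoolSR M

instance : isProjectiveSemimodule.IsMonoidal where
  prop_unit := (inferInstance : Module.Projective BoolSR BoolSR)
  prop_tensor M N hM hN := by
    have : Module.Projective BoolSR M := hM
    have : Module.Projective BoolSR N := hN
    exact (inferInstance : Module.Projective BoolSR (M ⊗[BoolSR] N))

/-- The symmetric monoidal category of projective `𝔹`-semimodules, with the tensor product over
`𝔹`. -/
abbrev BoolPMod : Type 1 := isProjectiveSemimodule.FullSubcategory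

/-! ## Decorated oriented one-dimensional cobordisms -/

/-- An oriented `0`-manifold: a finite set of points, divided into the positively and the
negatively oriented ones. It is an object of the cobordism category over the alphabet `A`. -/
structure CobH (A : Type u) : Type 1 where
  /-- the positively oriented points -/
  pos : Type
  /-- the negatively oriented points -/
  neg : Type
  [finite_pos : Finite pos]
  [finite_neg : Finite neg]

attribute [instance] CobH.finite_pos CobH.finite_neg

/-- An oriented segment with its defects, read along the orientation: either it carries a finite
word and runs into the point `h : H`, or it carries a right-infinite word, whose defects accumulate
towards an inner endpoint at which the segment ends. -/
inductive Strand (A : Type u) (H : Type) : Type u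
  | fin (w : List A) (h : H)
  | inf (ω : Stream' A)

namespace Strand

variable {A : Type u} {H H' H'' : Type}

/-- Put the finite word `w` in front of a segment. -/
def prepend (w : List A) : Strand A H → Strand A H
  | fin v h => fin (w ++ v) h
  | inf ω => inf (w ++ₛ ω)

/-- Rename the point which the segment runs into. -/
def map (f : H → H') : Strand A H → Strand A H'
  | fin w h => fin w (f h)
  | inf ω => inf ω

/-- Prolong a segment that runs into `h` by the segment `f h`. -/
def bind (s : Strand A H) (f : H → Strand A H') : Strand A H' :=
  match s with
  | fin w h => prepend w (f h)
  | inf ω => inf ω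

/-- The point which the segment runs into; `none` if it ends at an inner endpoint. -/
def head? : Strand A H → Option H
  | fin _ h => some h
  | inf _ => none

@[simp] theorem head?_map (f : H → H') (s : Strand A H) : (s.map f).head? = s.head?.map f := by
  cases s <;> rfl

@[simp] theorem map_map (f : H → H') (g : H' → H'') (s : Strand A H) :
    (s.map f).map g = s.map (g ∘ f) := by
  cases s <;> rfl

@[simp] theorem prepend_nil (s : Strand A H) : s.prepend [] = s := by
  cases s <;> simp [prepend]

theorem map_id' (f : H → H) (hf : ∀ h, f h = h) (s : Strand A H) : s.map f = s := by
  cases s <;> simp [map, hf]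

@[simp] theorem map_prepend (f : H → H') (w : List A) (s : Strand A H) :
    (s.prepend w).map f = (s.map f).prepend w := by
  cases s <;> rfl

theorem map_bind (s : Strand A H) (f : H → H') (g : H' → Strand A H'') :
    (s.map f).bind g = s.bind (g ∘ f) := by
  cases s <;> rfl

theorem bind_map (s : Strand A H) (f : H → Strand A H') (g : H' → H'') :
    (s.bind f).map g = s.bind (fun h => (f h).map g) := by
  cases s with
  | fin w h => exact map_prepend g w (f h)
  | inf ω => rfl

theorem bind_pure (s : Strand A H) (f : H → H') :
    s.bind (fun h => fin [] (f h)) = s.map f := by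
  cases s <;> simp [bind, map, prepend]

theorem map_congr (s : Strand A H) {f g : H → H'} (h : ∀ x, f x = g x) : s.map f = s.map g := by
  rw [funext h]

theorem map_eq₁₁ (s : Strand A H) {f : H → H'} {g : H → H''} {k : H'' → H'}
    (h : ∀ x, f x = k (g x)) : s.map f = (s.map g).map k := by
  rw [map_map]; congr 1; exact funext h

theorem map_eq₁₂ {H₁ : Type} (s : Strand A H) {f : H → H'} {g : H → H₁} {g' : H₁ → H''}
    {k : H'' → H'} (h : ∀ x, f x = k (g' (g x))) : s.map f = ((s.map g).map g').map k := by
  rw [map_map, map_map]; congr 1; exact funext h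

theorem map_eq₂₁ {H₁ : Type} (s : Strand A H) {f : H → H₁} {f' : H₁ → H'} {g : H → H''}
    {k : H'' → H'} (h : ∀ x, f' (f x) = k (g x)) : (s.map f).map f' = (s.map g).map k := by
  rw [map_map, map_map]; congr 1; exact funext h

theorem map_eq₂₂ {H₁ H₂ : Type} (s : Strand A H) {f : H → H₁} {f' : H₁ → H'} {g : H → H₂}
    {g' : H₂ → H''} {k : H'' → H'} (h : ∀ x, f' (f x) = k (g' (g x))) :
    (s.map f).map f' = ((s.map g).map g').map k := by
  rw [map_map, map_map, map_map]; congr 1; exact funext h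

theorem map_eq₂₃ {H₁ H₂ H₃ : Type} (s : Strand A H) {f : H → H₁} {f' : H₁ → H'} {g : H → H₂}
    {g' : H₂ → H₃} {g'' : H₃ → H''} {k : H'' → H'} (h : ∀ x, f' (f x) = k (g'' (g' (g x)))) :
    (s.map f).map f' = (((s.map g).map g').map g'').map k := by
  rw [map_map, map_map, map_map, map_map]; congr 1; exact funext h

theorem map_eq₃₂ {H₁ H₂ H₃ : Type} (s : Strand A H) {f : H → H₁} {f' : H₁ → H₂} {f'' : H₂ → H'}
    {g : H → H₃} {g' : H₃ → H''} {k : H'' → H'} (h : ∀ x, f'' (f' (f x)) = k (g' (g x))) :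
    ((s.map f).map f').map f'' = ((s.map g).map g').map k := by
  rw [map_map, map_map, map_map, map_map]; congr 1; exact funext h

theorem map_eq₃₃ {H₁ H₂ H₃ H₄ : Type} (s : Strand A H) {f : H → H₁} {f' : H₁ → H₂} {f'' : H₂ → H'}
    {g : H → H₃} {g' : H₃ → H₄} {g'' : H₄ → H''} {k : H'' → H'}
    (h : ∀ x, f'' (f' (f x)) = k (g'' (g' (g x)))) :
    ((s.map f).map f').map f'' = (((s.map g).map g').map g'').map k := by
  rw [map_map, map_map, map_map, map_map, map_map]; congr 1; exact funext h

theorem bind_congr (s : Strand A H) {f g : H → Strand A H'} (h : ∀ x, f x = g x) :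
    s.bind f = s.bind g := by
  rw [funext h]

end Strand

/-- Every point `h : H` is the end of exactly one of the segments `seg t`. -/
def Matched {A : Type u} {T H : Type} (seg : T → Strand A H) : Prop :=
  ∀ h : H, ∃! t : T, (seg t).head? = some h

theorem Matched.sum {A : Type u} {T₁ T₂ T H₁ H₂ H : Type} {s₁ : T₁ → Strand A H₁}
    {s₂ : T₂ → Strand A H₂} (m₁ : Matched s₁) (m₂ : Matched s₂) (seg : T → Strand A H)
    (t₁ : T₁ → T) (t₂ : T₂ → T) (h₁ : H₁ → H) (h₂ : H₂ → H)
    (ht : ∀ t, (∃ a, t₁ a = t) ∨ ∃ b, t₂ b = t)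
    (hh : ∀ h, (∃ a, h₁ a = h) ∨ ∃ b, h₂ b = h)
    (i₁ : Function.Injective h₁) (i₂ : Function.Injective h₂) (d : ∀ a b, h₁ a ≠ h₂ b)
    (e₁ : ∀ a, seg (t₁ a) = (s₁ a).map h₁) (e₂ : ∀ b, seg (t₂ b) = (s₂ b).map h₂) :
    Matched seg := by
  intro h
  rcases hh h with ⟨a, rfl⟩ | ⟨b, rfl⟩
  · obtain ⟨t, h1, h2⟩ := m₁ a
    refine ⟨t₁ t, by simp [e₁, h1], ?_⟩
    intro t' ht'
    rcases ht t' with ⟨c, rfl⟩ | ⟨c, rfl⟩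
    · simp only [e₁, Strand.head?_map, Option.map_eq_some_iff] at ht'
      obtain ⟨x, hx, hx'⟩ := ht'
      rw [h2 c (hx.trans (congrArg some (i₁ hx')))]
    · simp only [e₂, Strand.head?_map, Option.map_eq_some_iff] at ht'
      obtain ⟨x, hx, hx'⟩ := ht'
      exact absurd hx'.symm (d _ _)
  · obtain ⟨t, h1, h2⟩ := m₂ b
    refine ⟨t₂ t, by simp [e₂, h1], ?_⟩
    intro t' ht'
    rcases ht t' with ⟨c, rfl⟩ | ⟨c, rfl⟩
    · simp only [e₁, Strand.head?_map, Option.map_eq_some_iff] at ht'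
      obtain ⟨x, hx, hx'⟩ := ht'
      exact absurd hx' (d _ _)
    · simp only [e₂, Strand.head?_map, Option.map_eq_some_iff] at ht'
      obtain ⟨x, hx, hx'⟩ := ht'
      rw [h2 c (hx.trans (congrArg some (i₂ hx')))]

namespace CobH

variable {A : Type u}

/-- The places where a segment of a cobordism from `X` to `Y` can begin: a positive point of the
source (at the bottom), a negative point of the target (at the top), a cut point `j : J`, or an
inner endpoint `s : S`. -/
inductive Tail (X Y : CobH A) (J S : Type) : Type
  | bot (x : X.pos)
  | top (y : Y.neg)
  | cut (j : J)
  | inner (s : S)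

/-- The places where a segment of a cobordism from `X` to `Y` with a finite word can end: a positive
point of the target, a negative point of the source, or a cut point. -/
inductive Head (X Y : CobH A) (J : Type) : Type
  | top (y : Y.pos)
  | bot (x : X.neg)
  | cut (j : J)

/-- Rename cut points and inner endpoints. -/
def Tail.map {X Y : CobH A} {J J' S S' : Type} (f : J → J') (g : S → S') :
    Tail X Y J S → Tail X Y J' S'
  | .bot x => .bot x
  | .top y => .top y
  | .cut j => .cut (f j)
  | .inner s => .inner (g s)

/-- Rename cut points. -/
def Head.map {X Y : CobH A} {J J' : Type} (f : J → J') : Head X Y J → Head X Y J'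
  | .top y => .top y
  | .bot x => .bot x
  | .cut j => .cut (f j)

/-- A compact oriented one-dimensional cobordism from `X` to `Y` with `A`-labelled defects, which
is cut at finitely many points (not defects) of its interior into finitely many segments. The inner
endpoints at which the orientation points into the cobordism are the elements of `S`; the ones at
which it points out are the ends of the segments with right-infinite words.
One segment begins at each tail; one segment ends at each head. Closed components are those which
contain cut points only. -/
structure Cut (X Y : CobH A) : Type (max 1 u) where
  /-- the cut points -/
  J : Type
  /-- the inner endpoints oriented into the cobordism -/
  S : Type
  [finite_J : Finite J]
  [finite_S : Finite S]
  /-- the segment that begins at a given tail -/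
  seg : Tail X Y J S → Strand A (Head X Y J)
  matched : Matched seg

attribute [instance] Cut.finite_J Cut.finite_S

section erase

variable {X Y : CobH A} {J J' S S' : Type}

open Classical in
/-- Pass through the cut points that are not in `R`, along the segment that begins there. -/
noncomputable def pass (seg : Tail X Y J S → Strand A (Head X Y J)) (R : Set J) :
    Head X Y J → Strand A (Head X Y J)
  | .top y => .fin [] (.top y)
  | .bot x => .fin [] (.bot x)
  | .cut j => if j ∈ R then .fin [] (.cut j) else seg (.cut j)

/-- The family of segments `seg'` arises from `seg`, up to renaming of cut points and inner
endpoints, by erasing cut points: `r` embeds the cut points of `seg'` as those of `seg` that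
are kept; no segment of `seg` joins two erased cut points (so at least one cut point stays on every
circle); and at each erased cut point the two segments that meet there are joined and their words
concatenated. When no cut point is erased this is an isomorphism. -/
def EraseSeg (seg : Tail X Y J S → Strand A (Head X Y J))
    (seg' : Tail X Y J' S' → Strand A (Head X Y J')) : Prop :=
  ∃ (r : J' → J) (e : S' ≃ S), Function.Injective r ∧
    (∀ j ∉ Set.range r, ∀ j' ∉ Set.range r, (seg (.cut j)).head? ≠ some (.cut j')) ∧
    ∀ t, (seg (t.map r e)).bind (pass seg (Set.range r)) = (seg' t).map (Head.map r)

theorem pass_of_mem (seg : Tail X Y J S → Strand A (Head X Y J)) {R : Set J} {j : J} (h : j ∈ R) :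
    pass seg R (.cut j) = .fin [] (.cut j) := if_pos h

theorem pass_of_not_mem (seg : Tail X Y J S → Strand A (Head X Y J)) {R : Set J} {j : J}
    (h : j ∉ R) : pass seg R (.cut j) = seg (.cut j) := if_neg h

theorem bind_pass_univ (seg : Tail X Y J S → Strand A (Head X Y J)) {R : Set J} (hR : ∀ j, j ∈ R)
    (s : Strand A (Head X Y J)) : s.bind (pass seg R) = s := by
  have : pass seg R = fun h => .fin [] h := by
    funext h
    rcases h with y | x | j
    · rfl
    · rfl
    · exact pass_of_mem seg (hR j)
  rw [this, Strand.bind_pure, Strand.map_id' _ (fun _ => rfl)]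

theorem EraseSeg.of_equiv {seg : Tail X Y J S → Strand A (Head X Y J)}
    {seg' : Tail X Y J' S' → Strand A (Head X Y J')} (r : J' ≃ J) (e : S' ≃ S)
    (h : ∀ t, seg (t.map r e) = (seg' t).map (Head.map r)) : EraseSeg seg seg' := by
  refine ⟨r, e, r.injective, fun j hj => absurd (r.surjective j) hj, fun t => ?_⟩
  rw [bind_pass_univ (R := Set.range r) seg (fun j => r.surjective j), h]

theorem pass_map (seg : Tail X Y J S → Strand A (Head X Y J)) (r : J' → J) (h : Head X Y J') :
    pass seg (Set.range r) (h.map r) = .fin [] (h.map r) := by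
  rcases h with y | x | j
  · rfl
  · rfl
  · exact pass_of_mem seg ⟨j, rfl⟩

/-- Erasing cut points in one part of a family of segments. -/
theorem EraseSeg.extend {X₁ Y₁ : CobH A} {J₁ J₁' S₁ S₁' T₂ H₂ : Type}
    {seg₁ : Tail X₁ Y₁ J₁ S₁ → Strand A (Head X₁ Y₁ J₁)}
    {seg₁' : Tail X₁ Y₁ J₁' S₁' → Strand A (Head X₁ Y₁ J₁')} {seg₂ : T₂ → Strand A H₂}
    {seg : Tail X Y J S → Strand A (Head X Y J)} {seg' : Tail X Y J' S' → Strand A (Head X Y J')}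
    {r : J₁' → J₁} {e : S₁' ≃ S₁}
    (hi : ∀ j ∉ Set.range r, ∀ j' ∉ Set.range r, (seg₁ (.cut j)).head? ≠ some (.cut j'))
    (hs : ∀ t, (seg₁ (t.map r e)).bind (pass seg₁ (Set.range r)) = (seg₁' t).map (Head.map r))
    (i : J₁ → J) (rJ : J' → J) (eS : S' ≃ S)
    (tl : Tail X₁ Y₁ J₁ S₁ → Tail X Y J S) (tl' : Tail X₁ Y₁ J₁' S₁' → Tail X Y J' S')
    (hl : Head X₁ Y₁ J₁ → Head X Y J) (hl' : Head X₁ Y₁ J₁' → Head X Y J')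
    (tr : T₂ → Tail X Y J S) (tr' : T₂ → Tail X Y J' S')
    (hr : H₂ → Head X Y J) (hr' : H₂ → Head X Y J')
    (cover : ∀ t, (∃ a, tl' a = t) ∨ ∃ b, tr' b = t)
    (bl : ∀ t, seg (tl t) = (seg₁ t).map hl) (bl' : ∀ t, seg' (tl' t) = (seg₁' t).map hl')
    (br : ∀ t, seg (tr t) = (seg₂ t).map hr) (br' : ∀ t, seg' (tr' t) = (seg₂ t).map hr')
    (htl : ∀ t, (tl' t).map rJ eS = tl (t.map r e)) (htr : ∀ t, (tr' t).map rJ eS = tr t)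
    (hhl : ∀ h, (hl' h).map rJ = hl (h.map r)) (hhr : ∀ h, (hr' h).map rJ = hr h)
    (hlinj : Function.Injective hl) (rJinj : Function.Injective rJ)
    (cutt : ∀ j, tl (.cut j) = .cut (i j)) (cuth : ∀ j, hl (.cut j) = .cut (i j))
    (erased : ∀ j, j ∉ Set.range rJ ↔ ∃ j₁ ∉ Set.range r, i j₁ = j) : EraseSeg seg seg' := by
  have key : ∀ h, pass seg (Set.range rJ) (hl h) = (pass seg₁ (Set.range r) h).map hl := by
    intro h
    by_cases hh : ∃ h', Head.map r h' = h
    · obtain ⟨h', rfl⟩ := hh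
      rw [← hhl, pass_map, pass_map, Strand.map, hhl]
    · rcases h with y | x | j
      · exact absurd ⟨.top y, rfl⟩ hh
      · exact absurd ⟨.bot x, rfl⟩ hh
      · have hj : j ∉ Set.range r := by
          rintro ⟨a, rfl⟩
          exact hh ⟨.cut a, rfl⟩
        rw [pass_of_not_mem _ hj, cuth, pass_of_not_mem _ ((erased _).2 ⟨j, hj, rfl⟩), ← cutt, bl]
  refine ⟨rJ, eS, rJinj, ?_, ?_⟩
  · intro j hj j' hj' hc
    obtain ⟨a, ha, rfl⟩ := (erased j).1 hj
    obtain ⟨b, hb, rfl⟩ := (erased j').1 hj'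
    rw [← cutt, bl, Strand.head?_map, ← cuth, Option.map_eq_some_iff] at hc
    obtain ⟨c, hc, hc'⟩ := hc
    rw [hlinj hc'] at hc
    exact hi a ha b hb hc
  · intro t
    rcases cover t with ⟨t, rfl⟩ | ⟨t, rfl⟩
    · rw [htl, bl, bl', Strand.map_bind, Strand.map_map,
        Strand.bind_congr _ (f := pass seg (Set.range rJ) ∘ hl)
          (g := fun h => (pass seg₁ (Set.range r) h).map hl) key,
        ← Strand.bind_map, hs, Strand.map_map]
      congr 1
      funext h
      exact (hhl h).symm
    · rw [htr, br, br', Strand.map_bind, Strand.map_map,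
        Strand.bind_congr _ (g := fun h => .fin [] (hr h))
          (fun h => by rw [Function.comp_apply, ← hhr, pass_map]), Strand.bind_pure]
      congr 1
      funext h
      exact (hhr h).symm

theorem not_mem_range_left {M : Type} (r : J' → J) (j : J ⊕ M) :
    j ∉ Set.range (Sum.map r (id : M → M)) ↔ ∃ j₁ ∉ Set.range r, Sum.inl j₁ = j := by
  rcases j with j | m
  · simp
  · simp

theorem not_mem_range_right {M : Type} (r : J' → J) (j : M ⊕ J) :
    j ∉ Set.range (Sum.map (id : M → M) r) ↔ ∃ j₁ ∉ Set.range r, Sum.inr j₁ = j := by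
  rcases j with m | j
  · simp
  · simp

end erase

/-- Two cut cobordisms related by erasing cut points. -/
def Erase {X Y : CobH A} (D D' : Cut X Y) : Prop := EraseSeg D.seg D'.seg

/-- A morphism of the category: a decorated cobordism up to homeomorphism rel boundary, that is, a
cut cobordism up to isomorphism and up to the choice of the cut points (the equivalence relation
generated by `Erase`). -/
def Mor (X Y : CobH A) : Type (max 1 u) := Quot (Erase (X := X) (Y := Y))

/-! ### Composition -/

section comp

variable {X Y Z : CobH A} {J₁ J₂ S₁ S₂ : Type}

/-- Gluing: tails of the first cobordism. The points of `Y` become cut points. -/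
def tailL : Tail X Y J₁ S₁ → Tail X Z (J₁ ⊕ (Y.pos ⊕ Y.neg) ⊕ J₂) (S₁ ⊕ S₂)
  | .bot x => .bot x
  | .top y => .cut (.inr (.inl (.inr y)))
  | .cut j => .cut (.inl j)
  | .inner s => .inner (.inl s)

/-- Gluing: tails of the second cobordism. -/
def tailR : Tail Y Z J₂ S₂ → Tail X Z (J₁ ⊕ (Y.pos ⊕ Y.neg) ⊕ J₂) (S₁ ⊕ S₂)
  | .bot y => .cut (.inr (.inl (.inl y)))
  | .top z => .top z
  | .cut j => .cut (.inr (.inr j))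
  | .inner s => .inner (.inr s)

/-- Gluing: heads of the first cobordism. -/
def headL : Head X Y J₁ → Head X Z (J₁ ⊕ (Y.pos ⊕ Y.neg) ⊕ J₂)
  | .top y => .cut (.inr (.inl (.inl y)))
  | .bot x => .bot x
  | .cut j => .cut (.inl j)

/-- Gluing: heads of the second cobordism. -/
def headR : Head Y Z J₂ → Head X Z (J₁ ⊕ (Y.pos ⊕ Y.neg) ⊕ J₂)
  | .top z => .top z
  | .bot y => .cut (.inr (.inl (.inr y)))
  | .cut j => .cut (.inr (.inr j))

/-- The segments of the glued cobordism are the segments of the two pieces. -/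
def compSeg (D : Tail X Y J₁ S₁ → Strand A (Head X Y J₁))
    (E : Tail Y Z J₂ S₂ → Strand A (Head Y Z J₂)) :
    Tail X Z (J₁ ⊕ (Y.pos ⊕ Y.neg) ⊕ J₂) (S₁ ⊕ S₂) →
      Strand A (Head X Z (J₁ ⊕ (Y.pos ⊕ Y.neg) ⊕ J₂))
  | .bot x => (D (.bot x)).map headL
  | .top z => (E (.top z)).map headR
  | .cut (.inl j) => (D (.cut j)).map headL
  | .cut (.inr (.inl (.inl y))) => (E (.bot y)).map headR
  | .cut (.inr (.inl (.inr y))) => (D (.top y)).map headL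
  | .cut (.inr (.inr j)) => (E (.cut j)).map headR
  | .inner (.inl s) => (D (.inner s)).map headL
  | .inner (.inr s) => (E (.inner s)).map headR

theorem compSeg_tailL (D : Tail X Y J₁ S₁ → Strand A (Head X Y J₁))
    (E : Tail Y Z J₂ S₂ → Strand A (Head Y Z J₂)) (t : Tail X Y J₁ S₁) :
    compSeg D E (tailL t) = (D t).map headL := by
  cases t <;> rfl

theorem compSeg_tailR (D : Tail X Y J₁ S₁ → Strand A (Head X Y J₁))
    (E : Tail Y Z J₂ S₂ → Strand A (Head Y Z J₂)) (t : Tail Y Z J₂ S₂) :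
    compSeg D E (tailR t) = (E t).map headR := by
  cases t <;> rfl

theorem comp_cover (t : Tail X Z (J₁ ⊕ (Y.pos ⊕ Y.neg) ⊕ J₂) (S₁ ⊕ S₂)) :
    (∃ a : Tail X Y J₁ S₁, tailL a = t) ∨ ∃ b : Tail Y Z J₂ S₂, tailR b = t := by
  rcases t with x | z | (j | (y | y) | j) | (s | s)
  · exact .inl ⟨.bot x, rfl⟩
  · exact .inr ⟨.top z, rfl⟩
  · exact .inl ⟨.cut j, rfl⟩
  · exact .inr ⟨.bot y, rfl⟩
  · exact .inl ⟨.top y, rfl⟩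
  · exact .inr ⟨.cut j, rfl⟩
  · exact .inl ⟨.inner s, rfl⟩
  · exact .inr ⟨.inner s, rfl⟩

theorem headL_injective :
    Function.Injective (headL : Head X Y J₁ → Head X Z (J₁ ⊕ (Y.pos ⊕ Y.neg) ⊕ J₂)) := by
  rintro (_ | _ | _) (_ | _ | _) <;> simp [headL]

theorem headR_injective :
    Function.Injective (headR : Head Y Z J₂ → Head X Z (J₁ ⊕ (Y.pos ⊕ Y.neg) ⊕ J₂)) := by
  rintro (_ | _ | _) (_ | _ | _) <;> simp [headR]

/-- Gluing of cut cobordisms along `Y`. -/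
def Cut.comp (D : Cut X Y) (E : Cut Y Z) : Cut X Z where
  J := D.J ⊕ (Y.pos ⊕ Y.neg) ⊕ E.J
  S := D.S ⊕ E.S
  seg := compSeg D.seg E.seg
  matched := by
    refine D.matched.sum E.matched _ tailL tailR headL headR comp_cover ?_ headL_injective
      headR_injective ?_ (compSeg_tailL _ _) (compSeg_tailR _ _)
    · rintro (z | x | (j | (y | y) | j))
      · exact .inr ⟨.top z, rfl⟩
      · exact .inl ⟨.bot x, rfl⟩
      · exact .inl ⟨.cut j, rfl⟩
      · exact .inl ⟨.top y, rfl⟩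
      · exact .inr ⟨.bot y, rfl⟩
      · exact .inr ⟨.cut j, rfl⟩
    · rintro (_ | _ | _) (_ | _ | _) <;> simp [headL, headR]

theorem Erase.comp_left {D D' : Cut X Y} (h : Erase D D') (E : Cut Y Z) :
    Erase (D.comp E) (D'.comp E) := by
  obtain ⟨r, e, hr, hi, hs⟩ := h
  refine EraseSeg.extend hi hs Sum.inl (Sum.map r id) (Equiv.sumCongr e (.refl _)) tailL tailL
    headL headL tailR tailR headR headR comp_cover (compSeg_tailL _ _) (compSeg_tailL _ _)
    (compSeg_tailR _ E.seg) (compSeg_tailR _ E.seg) ?_ ?_ ?_ ?_ headL_injective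
    (hr.sumMap Function.injective_id) (fun _ => rfl) (fun _ => rfl) ?_
  · rintro (_ | _ | _ | _) <;> rfl
  · rintro (_ | _ | _ | _) <;> rfl
  · rintro (_ | _ | _) <;> rfl
  · rintro (_ | _ | _) <;> rfl
  · exact not_mem_range_left r

theorem Erase.comp_right (D : Cut X Y) {E E' : Cut Y Z} (h : Erase E E') :
    Erase (D.comp E) (D.comp E') := by
  obtain ⟨r, e, hr, hi, hs⟩ := h
  refine EraseSeg.extend hi hs (fun j => .inr (.inr j)) (Sum.map id (Sum.map id r))
    (Equiv.sumCongr (.refl _) e) tailR tailR headR headR tailL tailL headL headL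
    (fun t => (comp_cover t).symm) (compSeg_tailR _ _) (compSeg_tailR _ _) (compSeg_tailL D.seg _)
    (compSeg_tailL D.seg _) ?_ ?_ ?_ ?_ headR_injective
    (Function.injective_id.sumMap (Function.injective_id.sumMap hr)) (fun _ => rfl) (fun _ => rfl)
    ?_
  · rintro (_ | _ | _ | _) <;> rfl
  · rintro (_ | _ | _ | _) <;> rfl
  · rintro (_ | _ | _) <;> rfl
  · rintro (_ | _ | _) <;> rfl
  · intro j
    refine (not_mem_range_right (Sum.map id r) j).trans ⟨?_, ?_⟩
    · rintro ⟨a, ha, rfl⟩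
      obtain ⟨b, hb, rfl⟩ := (not_mem_range_right r a).1 ha
      exact ⟨b, hb, rfl⟩
    · rintro ⟨b, hb, rfl⟩
      exact ⟨.inr b, (not_mem_range_right r _).2 ⟨b, hb, rfl⟩, rfl⟩

/-- Composition of cobordisms. -/
def Mor.comp : Mor X Y → Mor Y Z → Mor X Z :=
  Quot.map₂ Cut.comp (fun D _ _ h => Erase.comp_right D h) (fun _ _ E h => Erase.comp_left h E)

theorem Mor.assoc {W : CobH A} (f : Mor W X) (g : Mor X Y) (h : Mor Y Z) :
    (f.comp g).comp h = f.comp (g.comp h) := by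
  induction f using Quot.ind with | mk D => ?_
  induction g using Quot.ind with | mk E => ?_
  induction h using Quot.ind with | mk F => ?_
  refine Quot.sound (EraseSeg.of_equiv
    { toFun := fun
        | .inl j => .inl (.inl j)
        | .inr (.inl x) => .inl (.inr (.inl x))
        | .inr (.inr (.inl j)) => .inl (.inr (.inr j))
        | .inr (.inr (.inr (.inl y))) => .inr (.inl y)
        | .inr (.inr (.inr (.inr j))) => .inr (.inr j)
      invFun := fun
        | .inl (.inl j) => .inl j
        | .inl (.inr (.inl x)) => .inr (.inl x)
        | .inl (.inr (.inr j)) => .inr (.inr (.inl j))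
        | .inr (.inl y) => .inr (.inr (.inr (.inl y)))
        | .inr (.inr j) => .inr (.inr (.inr (.inr j)))
      left_inv := by rintro (_ | _ | _ | _ | _) <;> rfl
      right_inv := by rintro ((_ | _ | _) | _ | _) <;> rfl }
    (Equiv.sumAssoc _ _ _).symm ?_)
  rintro (w | z | (j | (x | x) | j | (y | y) | j) | (s | s | s))
  · exact Strand.map_eq₂₁ (D.seg _) (by rintro (_ | _ | _) <;> rfl)
  · exact Strand.map_eq₁₂ (F.seg _) (by rintro (_ | _ | _) <;> rfl)
  · exact Strand.map_eq₂₁ (D.seg _) (by rintro (_ | _ | _) <;> rfl)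
  · exact Strand.map_eq₂₂ (E.seg _) (by rintro (_ | _ | _) <;> rfl)
  · exact Strand.map_eq₂₁ (D.seg _) (by rintro (_ | _ | _) <;> rfl)
  · exact Strand.map_eq₂₂ (E.seg _) (by rintro (_ | _ | _) <;> rfl)
  · exact Strand.map_eq₁₂ (F.seg _) (by rintro (_ | _ | _) <;> rfl)
  · exact Strand.map_eq₂₂ (E.seg _) (by rintro (_ | _ | _) <;> rfl)
  · exact Strand.map_eq₁₂ (F.seg _) (by rintro (_ | _ | _) <;> rfl)
  · exact Strand.map_eq₂₁ (D.seg _) (by rintro (_ | _ | _) <;> rfl)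
  · exact Strand.map_eq₂₂ (E.seg _) (by rintro (_ | _ | _) <;> rfl)
  · exact Strand.map_eq₁₂ (F.seg _) (by rintro (_ | _ | _) <;> rfl)

end comp

/-! ### Cobordisms given by bijections; identities -/

section ofEquiv

variable {X Y Z : CobH A}

/-- The cobordism without defects whose components are arcs joining the points of `X` and `Y` that
correspond to each other under an orientation-preserving bijection (a permutation of strands). -/
def Cut.ofEquiv (p : X.pos ≃ Y.pos) (n : X.neg ≃ Y.neg) : Cut X Y where
  J := Empty
  S := Empty
  seg
    | .bot x => .fin [] (.top (p x))
    | .top y => .fin [] (.bot (n.symm y))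
  matched := by
    rintro (y | x | ⟨⟨⟩⟩)
    · refine ⟨.bot (p.symm y), by simp [Strand.head?], ?_⟩
      rintro (x | y | ⟨⟨⟩⟩ | ⟨⟨⟩⟩) h
      · simp only [Strand.head?, Option.some.injEq, Head.top.injEq] at h
        simp [← h]
      · simp [Strand.head?] at h
    · refine ⟨.top (n x), by simp [Strand.head?], ?_⟩
      rintro (x | y | ⟨⟨⟩⟩ | ⟨⟨⟩⟩) h
      · simp [Strand.head?] at h
      · simp only [Strand.head?, Option.some.injEq, Head.bot.injEq] at h
        simp [← h]

/-- The class of `Cut.ofEquiv`. -/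
def Mor.ofEquiv (p : X.pos ≃ Y.pos) (n : X.neg ≃ Y.neg) : Mor X Y := Quot.mk _ (.ofEquiv p n)

/-- Rename the points of the source. -/
def Tail.renameSrc {J S : Type} (p : X.pos → Y.pos) : Tail X Z J S → Tail Y Z J S
  | .bot x => .bot (p x)
  | .top z => .top z
  | .cut j => .cut j
  | .inner s => .inner s

/-- Rename the points of the source. -/
def Head.renameSrc {J : Type} (n : Y.neg → X.neg) : Head Y Z J → Head X Z J
  | .top z => .top z
  | .bot y => .bot (n y)
  | .cut j => .cut j

/-- Rename the points of the target. -/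
def Tail.renameTgt {J S : Type} (n : Z.neg → Y.neg) : Tail X Z J S → Tail X Y J S
  | .bot x => .bot x
  | .top z => .top (n z)
  | .cut j => .cut j
  | .inner s => .inner s

/-- Rename the points of the target. -/
def Head.renameTgt {J : Type} (p : Y.pos → Z.pos) : Head X Y J → Head X Z J
  | .top y => .top (p y)
  | .bot x => .bot x
  | .cut j => .cut j

theorem Matched.rename {T₁ T H₁ H : Type} {s₁ : T₁ → Strand A H₁}
    (m₁ : Matched s₁) (seg : T → Strand A H)
    (t₁ : T₁ → T) (h₁ : H₁ → H) (ht : Function.Surjective t₁) (hh : Function.Bijective h₁)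
    (e₁ : ∀ a, seg (t₁ a) = (s₁ a).map h₁) : Matched seg :=
  m₁.sum (s₂ := fun e : Empty => e.elim) (H₂ := Empty) (fun e => e.elim) seg t₁ Empty.elim h₁
    Empty.elim (fun t => .inl (ht t)) (fun h => .inl (hh.2 h)) hh.1 (fun e => e.elim)
    (fun _ e => e.elim) e₁ (fun e => e.elim)

/-- Rename the points of the source along an orientation-preserving bijection. -/
def Cut.renameSrc (p : X.pos ≃ Y.pos) (n : X.neg ≃ Y.neg) (D : Cut Y Z) : Cut X Z where
  J := D.J
  S := D.S
  seg t := (D.seg (t.renameSrc p)).map (Head.renameSrc n.symm)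
  matched := by
    refine Matched.rename D.matched _ (Tail.renameSrc p.symm) (Head.renameSrc n.symm) ?_ ⟨?_, ?_⟩ ?_
    · rintro (x | z | j | s)
      · exact ⟨.bot (p x), by simp [Tail.renameSrc]⟩
      · exact ⟨.top z, rfl⟩
      · exact ⟨.cut j, rfl⟩
      · exact ⟨.inner s, rfl⟩
    · rintro (_ | _ | _) (_ | _ | _) <;> simp [Head.renameSrc]
    · rintro (z | x | j)
      · exact ⟨.top z, rfl⟩
      · exact ⟨.bot (n x), by simp [Head.renameSrc]⟩
      · exact ⟨.cut j, rfl⟩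
    · rintro (_ | _ | _ | _) <;> simp [Tail.renameSrc]

/-- Rename the points of the target along an orientation-preserving bijection. -/
def Cut.renameTgt (p : Y.pos ≃ Z.pos) (n : Y.neg ≃ Z.neg) (D : Cut X Y) : Cut X Z where
  J := D.J
  S := D.S
  seg t := (D.seg (t.renameTgt n.symm)).map (Head.renameTgt p)
  matched := by
    refine Matched.rename D.matched _ (Tail.renameTgt n) (Head.renameTgt p) ?_ ⟨?_, ?_⟩ ?_
    · rintro (x | z | j | s)
      · exact ⟨.bot x, rfl⟩
      · exact ⟨.top (n.symm z), by simp [Tail.renameTgt]⟩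
      · exact ⟨.cut j, rfl⟩
      · exact ⟨.inner s, rfl⟩
    · rintro (_ | _ | _) (_ | _ | _) <;> simp [Head.renameTgt]
    · rintro (z | x | j)
      · exact ⟨.top (p.symm z), by simp [Head.renameTgt]⟩
      · exact ⟨.bot x, rfl⟩
      · exact ⟨.cut j, rfl⟩
    · rintro (_ | _ | _ | _) <;> simp [Tail.renameTgt]

/-- Auxiliary: the points of `Y` which are heads of `D` are kept as cut points. -/
def srcHead {J : Type} : Head Y Z J → Head X Z (Y.neg ⊕ J)
  | .top z => .top z
  | .bot y => .cut (.inl y)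
  | .cut j => .cut (.inr j)

/-- Auxiliary: the composition of `Cut.ofEquiv` and `D` with half of the cut points erased. -/
def Cut.srcHalf (p : X.pos ≃ Y.pos) (n : X.neg ≃ Y.neg) (D : Cut Y Z) : Cut X Z where
  J := Y.neg ⊕ D.J
  S := D.S
  seg
    | .bot x => (D.seg (.bot (p x))).map srcHead
    | .top z => (D.seg (.top z)).map srcHead
    | .cut (.inl y) => .fin [] (.bot (n.symm y))
    | .cut (.inr j) => (D.seg (.cut j)).map srcHead
    | .inner s => (D.seg (.inner s)).map srcHead
  matched := by
    refine D.matched.sum (s₂ := fun x : X.neg => .fin [] x) (fun x => ⟨x, rfl, fun y h => ?_⟩) _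
      (fun | .bot y => .bot (p.symm y) | .top z => .top z | .cut j => .cut (.inr j)
           | .inner s => .inner s) (fun x => .cut (.inl (n x))) srcHead Head.bot ?_ ?_ ?_ ?_ ?_ ?_ ?_
    · exact Option.some_injective _ h
    · rintro (x | z | (y | j) | s)
      · exact .inl ⟨.bot (p x), by simp⟩
      · exact .inl ⟨.top z, rfl⟩
      · exact .inr ⟨n.symm y, by simp⟩
      · exact .inl ⟨.cut j, rfl⟩
      · exact .inl ⟨.inner s, rfl⟩
    · rintro (z | x | (y | j))
      · exact .inl ⟨.top z, rfl⟩
      · exact .inr ⟨x, rfl⟩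
      · exact .inl ⟨.bot y, rfl⟩
      · exact .inl ⟨.cut j, rfl⟩
    · rintro (_ | _ | _) (_ | _ | _) <;> simp [srcHead]
    · intro a b h
      exact Head.bot.inj h
    · rintro (_ | _ | _) _ <;> simp [srcHead]
    · rintro (_ | _ | _ | _) <;> simp
    · intro x
      simp [Strand.map]

theorem bind_map_pass {X Y : CobH A} {J J' S H : Type} (seg : Tail X Y J S → Strand A (Head X Y J))
    (r : J' → J) (s : Strand A H) (f : H → Head X Y J) (g : H → Head X Y J')
    (h : ∀ x, pass seg (Set.range r) (f x) = .fin [] ((g x).map r)) :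
    (s.map f).bind (pass seg (Set.range r)) = (s.map g).map (Head.map r) := by
  rw [Strand.map_bind, Strand.bind_congr _ (f := pass seg (Set.range r) ∘ f) h, Strand.bind_pure,
    Strand.map_map]
  rfl

/-- Auxiliary: the cut points kept in `Cut.srcHalf`. -/
def srcKeep {J : Type} : Y.neg ⊕ J → Empty ⊕ (Y.pos ⊕ Y.neg) ⊕ J
  | .inl y => .inr (.inl (.inr y))
  | .inr j => .inr (.inr j)

theorem srcHead_map {J : Type} (h : Head Y Z J) :
    (srcHead h : Head X Z _).map srcKeep = headR h := by
  cases h <;> rfl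

theorem Mor.ofEquiv_comp (p : X.pos ≃ Y.pos) (n : X.neg ≃ Y.neg) (D : Cut Y Z) :
    (Mor.ofEquiv p n).comp (Quot.mk _ D) = Quot.mk _ (D.renameSrc p n) := by
  have h1 : Erase ((Cut.ofEquiv p n).comp D) (D.srcHalf p n) := by
    have er : ∀ j ∉ Set.range (srcKeep : Y.neg ⊕ D.J → Empty ⊕ (Y.pos ⊕ Y.neg) ⊕ D.J),
        ∃ y, j = .inr (.inl (.inl y)) := by
      rintro (⟨⟨⟩⟩ | (y | y) | j) h
      · exact ⟨y, rfl⟩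
      · exact absurd ⟨.inl y, rfl⟩ h
      · exact absurd ⟨.inr j, rfl⟩ h
    have ps : ∀ h : Head Y Z D.J, pass (compSeg (Cut.ofEquiv p n).seg D.seg)
        (Set.range srcKeep) (headR h) = .fin [] ((srcHead h).map srcKeep) := by
      intro h
      exact (congrArg (pass _ _) (srcHead_map h).symm).trans (pass_map _ srcKeep _)
    refine ⟨srcKeep, (Equiv.emptySum Empty D.S).symm, ?_, ?_, ?_⟩
    · rintro (_ | _) (_ | _) h
      · cases h; rfl
      · cases h
      · cases h
      · cases h; rfl
    · intro j hj j' hj' hc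
      obtain ⟨y, rfl⟩ := er j hj
      obtain ⟨y', rfl⟩ := er j' hj'
      have hc' : ((D.seg (.bot y)).map (headR : _ → Head X Z (Empty ⊕ _))).head? =
        some (.cut (.inr (.inl (.inl y')))) := hc
      rw [Strand.head?_map, Option.map_eq_some_iff] at hc'
      obtain ⟨(_ | _ | _), _, h⟩ := hc' <;> simp [headR] at h
    · rintro (x | z | (y | j) | s)
      · have hn : (.inr (.inl (.inl (p x))) : Empty ⊕ (Y.pos ⊕ Y.neg) ⊕ D.J) ∉
            Set.range (srcKeep : Y.neg ⊕ D.J → _) := by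
          rintro ⟨(_ | _), h⟩ <;> simp [srcKeep] at h
        refine (Strand.prepend_nil _).trans ((pass_of_not_mem _ hn).trans ?_)
        exact Strand.map_eq₁₁ (D.seg (.bot (p x))) fun h => (srcHead_map h).symm
      · exact bind_map_pass _ srcKeep (D.seg (.top z)) headR srcHead ps
      · rfl
      · exact bind_map_pass _ srcKeep (D.seg (.cut j)) headR srcHead ps
      · exact bind_map_pass _ srcKeep (D.seg (.inner s)) headR srcHead ps
  have h2 : Erase (D.srcHalf p n) (D.renameSrc p n) := by
    have er : ∀ j ∉ Set.range (Sum.inr : D.J → Y.neg ⊕ D.J), ∃ y, j = .inl y := by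
      rintro (y | j) h
      · exact ⟨y, rfl⟩
      · exact absurd ⟨j, rfl⟩ h
    have ps : ∀ h : Head Y Z D.J, pass (D.srcHalf p n).seg (Set.range (Sum.inr : D.J → Y.neg ⊕ D.J))
        (srcHead h) = .fin [] ((h.renameSrc n.symm).map Sum.inr) := by
      rintro (z | y | j)
      · rfl
      · exact pass_of_not_mem _ (by rintro ⟨_, h⟩; cases h)
      · exact pass_of_mem _ ⟨j, rfl⟩
    refine ⟨Sum.inr, .refl _, Sum.inr_injective, ?_, ?_⟩
    · intro j hj j' hj' hc
      obtain ⟨y, rfl⟩ := er j hj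
      cases hc
    · rintro (x | z | j | s)
      · exact bind_map_pass _ Sum.inr (D.seg (.bot (p x))) srcHead (Head.renameSrc n.symm) ps
      · exact bind_map_pass _ Sum.inr (D.seg (.top z)) srcHead (Head.renameSrc n.symm) ps
      · exact bind_map_pass _ Sum.inr (D.seg (.cut j)) srcHead (Head.renameSrc n.symm) ps
      · exact bind_map_pass _ Sum.inr (D.seg (.inner s)) srcHead (Head.renameSrc n.symm) ps
  exact (Quot.sound h1).trans (Quot.sound h2)

/-- Auxiliary: the points of `Y` which are heads of `D` are kept as cut points. -/
def tgtHead {J : Type} : Head X Y J → Head X Z (J ⊕ Y.pos)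
  | .top y => .cut (.inr y)
  | .bot x => .bot x
  | .cut j => .cut (.inl j)

/-- Auxiliary: the composition of `D` and `Cut.ofEquiv` with half of the cut points erased. -/
def Cut.tgtHalf (p : Y.pos ≃ Z.pos) (n : Y.neg ≃ Z.neg) (D : Cut X Y) : Cut X Z where
  J := D.J ⊕ Y.pos
  S := D.S
  seg
    | .bot x => (D.seg (.bot x)).map tgtHead
    | .top z => (D.seg (.top (n.symm z))).map tgtHead
    | .cut (.inl j) => (D.seg (.cut j)).map tgtHead
    | .cut (.inr y) => .fin [] (.top (p y))
    | .inner s => (D.seg (.inner s)).map tgtHead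
  matched := by
    refine D.matched.sum (s₂ := fun z : Z.pos => .fin [] z) (fun x => ⟨x, rfl, fun y h => ?_⟩) _
      (fun | .bot x => .bot x | .top y => .top (n y) | .cut j => .cut (.inl j)
           | .inner s => .inner s) (fun z => .cut (.inr (p.symm z))) tgtHead Head.top
      ?_ ?_ ?_ ?_ ?_ ?_ ?_
    · exact Option.some_injective _ h
    · rintro (x | z | (j | y) | s)
      · exact .inl ⟨.bot x, rfl⟩
      · exact .inl ⟨.top (n.symm z), by simp⟩
      · exact .inl ⟨.cut j, rfl⟩
      · exact .inr ⟨p y, by simp⟩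
      · exact .inl ⟨.inner s, rfl⟩
    · rintro (z | x | (j | y))
      · exact .inr ⟨z, rfl⟩
      · exact .inl ⟨.bot x, rfl⟩
      · exact .inl ⟨.cut j, rfl⟩
      · exact .inl ⟨.top y, rfl⟩
    · rintro (_ | _ | _) (_ | _ | _) <;> simp [tgtHead]
    · intro a b h
      exact Head.top.inj h
    · rintro (_ | _ | _) _ <;> simp [tgtHead]
    · rintro (_ | _ | _ | _) <;> simp
    · intro x
      simp [Strand.map]

/-- Auxiliary: the cut points kept in `Cut.tgtHalf`. -/
def tgtKeep {J : Type} : J ⊕ Y.pos → J ⊕ (Y.pos ⊕ Y.neg) ⊕ Empty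
  | .inl j => .inl j
  | .inr y => .inr (.inl (.inl y))

theorem tgtHead_map {J : Type} (h : Head X Y J) :
    (tgtHead h : Head X Z _).map tgtKeep = headL h := by
  cases h <;> rfl

theorem Mor.comp_ofEquiv (p : Y.pos ≃ Z.pos) (n : Y.neg ≃ Z.neg) (D : Cut X Y) :
    Mor.comp (Quot.mk _ D) (Mor.ofEquiv p n) = Quot.mk _ (D.renameTgt p n) := by
  have h1 : Erase (D.comp (Cut.ofEquiv p n)) (D.tgtHalf p n) := by
    have er : ∀ j ∉ Set.range (tgtKeep : D.J ⊕ Y.pos → D.J ⊕ (Y.pos ⊕ Y.neg) ⊕ Empty),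
        ∃ y, j = .inr (.inl (.inr y)) := by
      rintro (j | (y | y) | ⟨⟨⟩⟩) h
      · exact absurd ⟨.inl j, rfl⟩ h
      · exact absurd ⟨.inr y, rfl⟩ h
      · exact ⟨y, rfl⟩
    have ps : ∀ h : Head X Y D.J, pass (compSeg D.seg (Cut.ofEquiv p n).seg)
        (Set.range tgtKeep) (headL h) = .fin [] ((tgtHead h).map tgtKeep) := by
      intro h
      exact (congrArg (pass _ _) (tgtHead_map h).symm).trans (pass_map _ tgtKeep _)
    refine ⟨tgtKeep, (Equiv.sumEmpty D.S Empty).symm, ?_, ?_, ?_⟩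
    · rintro (_ | _) (_ | _) h
      · cases h; rfl
      · cases h
      · cases h
      · cases h; rfl
    · intro j hj j' hj' hc
      obtain ⟨y, rfl⟩ := er j hj
      obtain ⟨y', rfl⟩ := er j' hj'
      have hc' : ((D.seg (.top y)).map (headL : _ → Head X Z (_ ⊕ _ ⊕ Empty))).head? =
        some (.cut (.inr (.inl (.inr y')))) := hc
      rw [Strand.head?_map, Option.map_eq_some_iff] at hc'
      obtain ⟨(_ | _ | _), _, h⟩ := hc' <;> simp [headL] at h
    · rintro (x | z | (j | y) | s)
      · exact bind_map_pass _ tgtKeep (D.seg (.bot x)) headL tgtHead ps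
      · have hn : (.inr (.inl (.inr (n.symm z))) : D.J ⊕ (Y.pos ⊕ Y.neg) ⊕ Empty) ∉
            Set.range (tgtKeep : D.J ⊕ Y.pos → _) := by
          rintro ⟨(_ | _), h⟩ <;> simp [tgtKeep] at h
        refine (Strand.prepend_nil _).trans ((pass_of_not_mem _ hn).trans ?_)
        exact Strand.map_eq₁₁ (D.seg (.top (n.symm z))) fun h => (tgtHead_map h).symm
      · exact bind_map_pass _ tgtKeep (D.seg (.cut j)) headL tgtHead ps
      · rfl
      · exact bind_map_pass _ tgtKeep (D.seg (.inner s)) headL tgtHead ps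
  have h2 : Erase (D.tgtHalf p n) (D.renameTgt p n) := by
    have er : ∀ j ∉ Set.range (Sum.inl : D.J → D.J ⊕ Y.pos), ∃ y, j = .inr y := by
      rintro (j | y) h
      · exact absurd ⟨j, rfl⟩ h
      · exact ⟨y, rfl⟩
    have ps : ∀ h : Head X Y D.J, pass (D.tgtHalf p n).seg (Set.range (Sum.inl : D.J → D.J ⊕ Y.pos))
        (tgtHead h) = .fin [] ((h.renameTgt p).map Sum.inl) := by
      rintro (y | x | j)
      · exact pass_of_not_mem _ (by rintro ⟨_, h⟩; cases h)
      · rfl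
      · exact pass_of_mem _ ⟨j, rfl⟩
    refine ⟨Sum.inl, .refl _, Sum.inl_injective, ?_, ?_⟩
    · intro j hj j' hj' hc
      obtain ⟨y, rfl⟩ := er j hj
      cases hc
    · rintro (x | z | j | s)
      · exact bind_map_pass _ Sum.inl (D.seg (.bot x)) tgtHead (Head.renameTgt p) ps
      · exact bind_map_pass _ Sum.inl (D.seg (.top (n.symm z))) tgtHead (Head.renameTgt p) ps
      · exact bind_map_pass _ Sum.inl (D.seg (.cut j)) tgtHead (Head.renameTgt p) ps
      · exact bind_map_pass _ Sum.inl (D.seg (.inner s)) tgtHead (Head.renameTgt p) ps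
  exact (Quot.sound h1).trans (Quot.sound h2)

theorem Mor.ofEquiv_comp_ofEquiv (p : X.pos ≃ Y.pos) (n : X.neg ≃ Y.neg) (p' : Y.pos ≃ Z.pos)
    (n' : Y.neg ≃ Z.neg) :
    (Mor.ofEquiv p n).comp (Mor.ofEquiv p' n') = Mor.ofEquiv (p.trans p') (n.trans n') := by
  refine (Mor.ofEquiv_comp p n _).trans (Quot.sound (EraseSeg.of_equiv (.refl _) (.refl _) ?_))
  rintro (x | z | ⟨⟨⟩⟩ | ⟨⟨⟩⟩) <;> rfl

end ofEquiv

/-- Cobordisms form a category; the identity is the cylinder without defects. -/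
instance : Category.{max 1 u} (CobH A) where
  Hom := Mor
  id _ := Mor.ofEquiv (.refl _) (.refl _)
  comp := Mor.comp
  id_comp f := by
    induction f using Quot.ind with | mk D => ?_
    refine (Mor.ofEquiv_comp _ _ D).trans (Quot.sound (EraseSeg.of_equiv (.refl _) (.refl _) ?_))
    rintro (x | z | j | s) <;>
      exact Strand.map_congr (D.seg _) (by rintro (_ | _ | _) <;> rfl)
  comp_id f := by
    induction f using Quot.ind with | mk D => ?_
    refine (Mor.comp_ofEquiv _ _ D).trans (Quot.sound (EraseSeg.of_equiv (.refl _) (.refl _) ?_))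
    rintro (x | z | j | s) <;>
      exact Strand.map_congr (D.seg _) (by rintro (_ | _ | _) <;> rfl)
  assoc := Mor.assoc

/-! ### The symmetric monoidal structure: disjoint union -/

section tensor

variable {X₁ Y₁ X₂ Y₂ Z₁ Z₂ : CobH A} {J₁ J₂ S₁ S₂ : Type}

/-- The disjoint union of oriented `0`-manifolds. -/
def union (X Y : CobH A) : CobH A where
  pos := X.pos ⊕ Y.pos
  neg := X.neg ⊕ Y.neg

/-- The empty `0`-manifold. -/
def empty (A : Type u) : CobH A where
  pos := Empty
  neg := Empty

/-- Disjoint union: tails of the first cobordism. -/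
def tailInl : Tail X₁ Y₁ J₁ S₁ → Tail (union X₁ X₂) (union Y₁ Y₂) (J₁ ⊕ J₂) (S₁ ⊕ S₂)
  | .bot x => .bot (.inl x)
  | .top y => .top (.inl y)
  | .cut j => .cut (.inl j)
  | .inner s => .inner (.inl s)

/-- Disjoint union: tails of the second cobordism. -/
def tailInr : Tail X₂ Y₂ J₂ S₂ → Tail (union X₁ X₂) (union Y₁ Y₂) (J₁ ⊕ J₂) (S₁ ⊕ S₂)
  | .bot x => .bot (.inr x)
  | .top y => .top (.inr y)
  | .cut j => .cut (.inr j)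
  | .inner s => .inner (.inr s)

/-- Disjoint union: heads of the first cobordism. -/
def headInl : Head X₁ Y₁ J₁ → Head (union X₁ X₂) (union Y₁ Y₂) (J₁ ⊕ J₂)
  | .top y => .top (.inl y)
  | .bot x => .bot (.inl x)
  | .cut j => .cut (.inl j)

/-- Disjoint union: heads of the second cobordism. -/
def headInr : Head X₂ Y₂ J₂ → Head (union X₁ X₂) (union Y₁ Y₂) (J₁ ⊕ J₂)
  | .top y => .top (.inr y)
  | .bot x => .bot (.inr x)
  | .cut j => .cut (.inr j)

/-- The segments of a disjoint union are the segments of the two pieces. -/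
def tensorSeg (D : Tail X₁ Y₁ J₁ S₁ → Strand A (Head X₁ Y₁ J₁))
    (E : Tail X₂ Y₂ J₂ S₂ → Strand A (Head X₂ Y₂ J₂)) :
    Tail (union X₁ X₂) (union Y₁ Y₂) (J₁ ⊕ J₂) (S₁ ⊕ S₂) →
      Strand A (Head (union X₁ X₂) (union Y₁ Y₂) (J₁ ⊕ J₂))
  | .bot (.inl x) => (D (.bot x)).map headInl
  | .bot (.inr x) => (E (.bot x)).map headInr
  | .top (.inl y) => (D (.top y)).map headInl
  | .top (.inr y) => (E (.top y)).map headInr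
  | .cut (.inl j) => (D (.cut j)).map headInl
  | .cut (.inr j) => (E (.cut j)).map headInr
  | .inner (.inl s) => (D (.inner s)).map headInl
  | .inner (.inr s) => (E (.inner s)).map headInr

theorem tensorSeg_inl (D : Tail X₁ Y₁ J₁ S₁ → Strand A (Head X₁ Y₁ J₁))
    (E : Tail X₂ Y₂ J₂ S₂ → Strand A (Head X₂ Y₂ J₂)) (t : Tail X₁ Y₁ J₁ S₁) :
    tensorSeg D E (tailInl t) = (D t).map headInl := by
  cases t <;> rfl

theorem tensorSeg_inr (D : Tail X₁ Y₁ J₁ S₁ → Strand A (Head X₁ Y₁ J₁))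
    (E : Tail X₂ Y₂ J₂ S₂ → Strand A (Head X₂ Y₂ J₂)) (t : Tail X₂ Y₂ J₂ S₂) :
    tensorSeg D E (tailInr t) = (E t).map headInr := by
  cases t <;> rfl

theorem tensor_cover (t : Tail (union X₁ X₂) (union Y₁ Y₂) (J₁ ⊕ J₂) (S₁ ⊕ S₂)) :
    (∃ a : Tail X₁ Y₁ J₁ S₁, tailInl a = t) ∨ ∃ b : Tail X₂ Y₂ J₂ S₂, tailInr b = t := by
  rcases t with (x | x) | (y | y) | (j | j) | (s | s)
  · exact .inl ⟨.bot x, rfl⟩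
  · exact .inr ⟨.bot x, rfl⟩
  · exact .inl ⟨.top y, rfl⟩
  · exact .inr ⟨.top y, rfl⟩
  · exact .inl ⟨.cut j, rfl⟩
  · exact .inr ⟨.cut j, rfl⟩
  · exact .inl ⟨.inner s, rfl⟩
  · exact .inr ⟨.inner s, rfl⟩

theorem headInl_injective : Function.Injective
    (headInl : Head X₁ Y₁ J₁ → Head (union X₁ X₂) (union Y₁ Y₂) (J₁ ⊕ J₂)) := by
  rintro (_ | _ | _) (_ | _ | _) h <;> cases h <;> rfl

theorem headInr_injective : Function.Injective
    (headInr : Head X₂ Y₂ J₂ → Head (union X₁ X₂) (union Y₁ Y₂) (J₁ ⊕ J₂)) := by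
  rintro (_ | _ | _) (_ | _ | _) h <;> cases h <;> rfl

/-- The disjoint union of cut cobordisms. -/
def Cut.tensor (D : Cut X₁ Y₁) (E : Cut X₂ Y₂) : Cut (union X₁ X₂) (union Y₁ Y₂) where
  J := D.J ⊕ E.J
  S := D.S ⊕ E.S
  seg := tensorSeg D.seg E.seg
  matched := by
    refine D.matched.sum E.matched _ tailInl tailInr headInl headInr tensor_cover ?_
      headInl_injective headInr_injective ?_ (tensorSeg_inl _ _) (tensorSeg_inr _ _)
    · rintro ((y | y) | (x | x) | (j | j))
      · exact .inl ⟨.top y, rfl⟩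
      · exact .inr ⟨.top y, rfl⟩
      · exact .inl ⟨.bot x, rfl⟩
      · exact .inr ⟨.bot x, rfl⟩
      · exact .inl ⟨.cut j, rfl⟩
      · exact .inr ⟨.cut j, rfl⟩
    · rintro (_ | _ | _) (_ | _ | _) h <;> cases h

theorem Erase.tensor_left {D D' : Cut X₁ Y₁} (h : Erase D D') (E : Cut X₂ Y₂) :
    Erase (D.tensor E) (D'.tensor E) := by
  obtain ⟨r, e, hr, hi, hs⟩ := h
  refine EraseSeg.extend hi hs Sum.inl (Sum.map r id) (Equiv.sumCongr e (.refl _)) tailInl tailInl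
    headInl headInl tailInr tailInr headInr headInr tensor_cover (tensorSeg_inl _ _)
    (tensorSeg_inl _ _) (tensorSeg_inr _ E.seg) (tensorSeg_inr _ E.seg) ?_ ?_ ?_ ?_
    headInl_injective (hr.sumMap Function.injective_id) (fun _ => rfl) (fun _ => rfl)
    (not_mem_range_left r)
  · rintro (_ | _ | _ | _) <;> rfl
  · rintro (_ | _ | _ | _) <;> rfl
  · rintro (_ | _ | _) <;> rfl
  · rintro (_ | _ | _) <;> rfl

theorem Erase.tensor_right (D : Cut X₁ Y₁) {E E' : Cut X₂ Y₂} (h : Erase E E') :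
    Erase (D.tensor E) (D.tensor E') := by
  obtain ⟨r, e, hr, hi, hs⟩ := h
  refine EraseSeg.extend hi hs Sum.inr (Sum.map id r) (Equiv.sumCongr (.refl _) e) tailInr tailInr
    headInr headInr tailInl tailInl headInl headInl (fun t => (tensor_cover t).symm)
    (tensorSeg_inr _ _) (tensorSeg_inr _ _) (tensorSeg_inl D.seg _) (tensorSeg_inl D.seg _)
    ?_ ?_ ?_ ?_ headInr_injective (Function.injective_id.sumMap hr) (fun _ => rfl) (fun _ => rfl)
    (not_mem_range_right r)
  · rintro (_ | _ | _ | _) <;> rfl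
  · rintro (_ | _ | _ | _) <;> rfl
  · rintro (_ | _ | _) <;> rfl
  · rintro (_ | _ | _) <;> rfl

/-- The disjoint union of cobordisms. -/
def Mor.tensor : Mor X₁ Y₁ → Mor X₂ Y₂ → Mor (union X₁ X₂) (union Y₁ Y₂) :=
  Quot.map₂ Cut.tensor (fun D _ _ h => Erase.tensor_right D h)
    (fun _ _ E h => Erase.tensor_left h E)

theorem Mor.tensor_ofEquiv (p₁ : X₁.pos ≃ Y₁.pos) (n₁ : X₁.neg ≃ Y₁.neg) (p₂ : X₂.pos ≃ Y₂.pos)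
    (n₂ : X₂.neg ≃ Y₂.neg) :
    (Mor.ofEquiv p₁ n₁).tensor (Mor.ofEquiv p₂ n₂) =
      Mor.ofEquiv (X := union X₁ X₂) (Y := union Y₁ Y₂) (p₁.sumCongr p₂) (n₁.sumCongr n₂) := by
  refine Quot.sound (EraseSeg.of_equiv (Equiv.emptySum Empty Empty).symm
    (Equiv.emptySum Empty Empty).symm ?_)
  rintro ((x | x) | (y | y) | ⟨⟨⟩⟩ | ⟨⟨⟩⟩) <;> rfl

theorem Mor.tensor_comp_tensor (f₁ : Mor X₁ Y₁) (f₂ : Mor X₂ Y₂) (g₁ : Mor Y₁ Z₁)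
    (g₂ : Mor Y₂ Z₂) :
    (f₁.tensor f₂).comp (g₁.tensor g₂) = (f₁.comp g₁).tensor (f₂.comp g₂) := by
  induction f₁ using Quot.ind with | mk D₁ => ?_
  induction f₂ using Quot.ind with | mk D₂ => ?_
  induction g₁ using Quot.ind with | mk E₁ => ?_
  induction g₂ using Quot.ind with | mk E₂ => ?_
  refine Quot.sound (EraseSeg.of_equiv
    { toFun := fun
        | .inl (.inl j) => .inl (.inl j)
        | .inl (.inr (.inl (.inl y))) => .inr (.inl (.inl (.inl y)))
        | .inl (.inr (.inl (.inr y))) => .inr (.inl (.inr (.inl y)))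
        | .inl (.inr (.inr j)) => .inr (.inr (.inl j))
        | .inr (.inl j) => .inl (.inr j)
        | .inr (.inr (.inl (.inl y))) => .inr (.inl (.inl (.inr y)))
        | .inr (.inr (.inl (.inr y))) => .inr (.inl (.inr (.inr y)))
        | .inr (.inr (.inr j)) => .inr (.inr (.inr j))
      invFun := fun
        | .inl (.inl j) => .inl (.inl j)
        | .inl (.inr j) => .inr (.inl j)
        | .inr (.inl (.inl (.inl y))) => .inl (.inr (.inl (.inl y)))
        | .inr (.inl (.inl (.inr y))) => .inr (.inr (.inl (.inl y)))
        | .inr (.inl (.inr (.inl y))) => .inl (.inr (.inl (.inr y)))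
        | .inr (.inl (.inr (.inr y))) => .inr (.inr (.inl (.inr y)))
        | .inr (.inr (.inl j)) => .inl (.inr (.inr j))
        | .inr (.inr (.inr j)) => .inr (.inr (.inr j))
      left_inv := by rintro ((_ | (_ | _) | _) | (_ | (_ | _) | _)) <;> rfl
      right_inv := by rintro ((_ | _) | ((_ | _) | (_ | _)) | (_ | _)) <;> rfl }
    (Equiv.sumSumSumComm _ _ _ _) ?_)
  rintro ((x | x) | (z | z) | ((j | (y | y) | j) | (j | (y | y) | j)) | ((s | s) | (s | s)))
  · exact Strand.map_eq₂₂ (D₁.seg _) (by rintro (_ | _ | _) <;> rfl)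
  · exact Strand.map_eq₂₂ (D₂.seg _) (by rintro (_ | _ | _) <;> rfl)
  · exact Strand.map_eq₂₂ (E₁.seg _) (by rintro (_ | _ | _) <;> rfl)
  · exact Strand.map_eq₂₂ (E₂.seg _) (by rintro (_ | _ | _) <;> rfl)
  · exact Strand.map_eq₂₂ (D₁.seg _) (by rintro (_ | _ | _) <;> rfl)
  · exact Strand.map_eq₂₂ (E₁.seg _) (by rintro (_ | _ | _) <;> rfl)
  · exact Strand.map_eq₂₂ (D₁.seg _) (by rintro (_ | _ | _) <;> rfl)
  · exact Strand.map_eq₂₂ (E₁.seg _) (by rintro (_ | _ | _) <;> rfl)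
  · exact Strand.map_eq₂₂ (D₂.seg _) (by rintro (_ | _ | _) <;> rfl)
  · exact Strand.map_eq₂₂ (E₂.seg _) (by rintro (_ | _ | _) <;> rfl)
  · exact Strand.map_eq₂₂ (D₂.seg _) (by rintro (_ | _ | _) <;> rfl)
  · exact Strand.map_eq₂₂ (E₂.seg _) (by rintro (_ | _ | _) <;> rfl)
  · exact Strand.map_eq₂₂ (D₁.seg _) (by rintro (_ | _ | _) <;> rfl)
  · exact Strand.map_eq₂₂ (E₁.seg _) (by rintro (_ | _ | _) <;> rfl)
  · exact Strand.map_eq₂₂ (D₂.seg _) (by rintro (_ | _ | _) <;> rfl)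
  · exact Strand.map_eq₂₂ (E₂.seg _) (by rintro (_ | _ | _) <;> rfl)

end tensor

/-- An orientation-preserving bijection of `0`-manifolds is an isomorphism of cobordisms. -/
def isoOfEquiv {X Y : CobH A} (p : X.pos ≃ Y.pos) (n : X.neg ≃ Y.neg) : X ≅ Y where
  hom := Mor.ofEquiv p n
  inv := Mor.ofEquiv p.symm n.symm
  hom_inv_id := by
    refine (Mor.ofEquiv_comp_ofEquiv p n p.symm n.symm).trans ?_
    rw [Equiv.self_trans_symm, Equiv.self_trans_symm]
    rfl
  inv_hom_id := by
    refine (Mor.ofEquiv_comp_ofEquiv p.symm n.symm p n).trans ?_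
    rw [Equiv.symm_trans_self, Equiv.symm_trans_self]
    rfl

instance : MonoidalCategoryStruct (CobH A) where
  tensorObj := union
  tensorUnit := empty A
  tensorHom := Mor.tensor
  whiskerLeft X _ _ f := Mor.tensor (𝟙 X) f
  whiskerRight f Y := Mor.tensor f (𝟙 Y)
  associator X Y Z := isoOfEquiv (X := union (union X Y) Z) (Y := union X (union Y Z))
    (Equiv.sumAssoc _ _ _) (Equiv.sumAssoc _ _ _)
  leftUnitor X := isoOfEquiv (X := union (empty A) X) (Equiv.emptySum Empty _)
    (Equiv.emptySum Empty _)
  rightUnitor X := isoOfEquiv (X := union X (empty A)) (Equiv.sumEmpty _ Empty)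
    (Equiv.sumEmpty _ Empty)

theorem ofEquiv_naturality {X Y X' Y' : CobH A} (p : X.pos ≃ X'.pos) (n : X.neg ≃ X'.neg)
    (p' : Y.pos ≃ Y'.pos) (n' : Y.neg ≃ Y'.neg) (D : Cut X Y) (D' : Cut X' Y') (r : D'.J ≃ D.J)
    (e : D'.S ≃ D.S)
    (h : ∀ t : Tail X Y' D'.J D'.S, (D.seg ((t.renameTgt n'.symm).map r e)).map (Head.renameTgt p') =
      ((D'.seg (t.renameSrc p)).map (Head.renameSrc n.symm)).map (Head.map r)) :
    Mor.comp (Quot.mk _ D) (Mor.ofEquiv p' n') = (Mor.ofEquiv p n).comp (Quot.mk _ D') := by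
  rw [Mor.comp_ofEquiv, Mor.ofEquiv_comp]
  refine Quot.sound (EraseSeg.of_equiv r e fun t => ?_)
  refine Eq.trans ?_ (h t)
  cases t <;> rfl

theorem ofEquiv_congr {X Y : CobH A} {p p' : X.pos ≃ Y.pos} {n n' : X.neg ≃ Y.neg}
    (hp : ∀ x, p x = p' x) (hn : ∀ x, n x = n' x) : Mor.ofEquiv p n = Mor.ofEquiv p' n' := by
  rw [Equiv.ext hp, Equiv.ext hn]

theorem comp_eq_ofEquiv {X Y Z : CobH A} {p : X.pos ≃ Y.pos} {n : X.neg ≃ Y.neg}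
    {p' : Y.pos ≃ Z.pos} {n' : Y.neg ≃ Z.neg} {f : Mor X Y} {g : Mor Y Z}
    (hf : f = Mor.ofEquiv p n) (hg : g = Mor.ofEquiv p' n') :
    f.comp g = Mor.ofEquiv (p.trans p') (n.trans n') := by
  rw [hf, hg, Mor.ofEquiv_comp_ofEquiv]

theorem tensor_eq_ofEquiv {X₁ Y₁ X₂ Y₂ : CobH A} {p : X₁.pos ≃ Y₁.pos} {n : X₁.neg ≃ Y₁.neg}
    {p' : X₂.pos ≃ Y₂.pos} {n' : X₂.neg ≃ Y₂.neg} {f : Mor X₁ Y₁} {g : Mor X₂ Y₂}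
    (hf : f = Mor.ofEquiv p n) (hg : g = Mor.ofEquiv p' n') :
    f.tensor g = Mor.ofEquiv (X := union X₁ X₂) (Y := union Y₁ Y₂) (p.sumCongr p')
      (n.sumCongr n') := by
  rw [hf, hg, Mor.tensor_ofEquiv]

instance : MonoidalCategory (CobH A) := MonoidalCategory.ofTensorHom
  (id_tensorHom_id := fun X Y => by
    refine (Mor.tensor_ofEquiv _ _ _ _).trans (ofEquiv_congr ?_ ?_) <;> rintro (_ | _) <;> rfl)
  (tensorHom_comp_tensorHom := Mor.tensor_comp_tensor)
  (associator_naturality := fun f g h => by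
    induction f using Quot.ind with | mk D => ?_
    induction g using Quot.ind with | mk E => ?_
    induction h using Quot.ind with | mk F => ?_
    refine ofEquiv_naturality _ _ _ _ ((D.tensor E).tensor F) (D.tensor (E.tensor F))
      (Equiv.sumAssoc _ _ _).symm (Equiv.sumAssoc _ _ _).symm ?_
    rintro (((x | x) | x) | (y | y | y) | (j | j | j) | (s | s | s))
    · exact Strand.map_eq₃₂ (D.seg _) (by rintro (_ | _ | _) <;> rfl)
    · exact Strand.map_eq₃₃ (E.seg _) (by rintro (_ | _ | _) <;> rfl)
    · exact Strand.map_eq₂₃ (F.seg _) (by rintro (_ | _ | _) <;> rfl)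
    · exact Strand.map_eq₃₂ (D.seg _) (by rintro (_ | _ | _) <;> rfl)
    · exact Strand.map_eq₃₃ (E.seg _) (by rintro (_ | _ | _) <;> rfl)
    · exact Strand.map_eq₂₃ (F.seg _) (by rintro (_ | _ | _) <;> rfl)
    · exact Strand.map_eq₃₂ (D.seg _) (by rintro (_ | _ | _) <;> rfl)
    · exact Strand.map_eq₃₃ (E.seg _) (by rintro (_ | _ | _) <;> rfl)
    · exact Strand.map_eq₂₃ (F.seg _) (by rintro (_ | _ | _) <;> rfl)
    · exact Strand.map_eq₃₂ (D.seg _) (by rintro (_ | _ | _) <;> rfl)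
    · exact Strand.map_eq₃₃ (E.seg _) (by rintro (_ | _ | _) <;> rfl)
    · exact Strand.map_eq₂₃ (F.seg _) (by rintro (_ | _ | _) <;> rfl))
  (leftUnitor_naturality := fun f => by
    induction f using Quot.ind with | mk D => ?_
    refine ofEquiv_naturality _ _ _ _ ((Cut.ofEquiv _ _).tensor D) D
      (Equiv.emptySum Empty _).symm (Equiv.emptySum Empty _).symm ?_
    rintro ((⟨⟨⟩⟩ | x) | y | j | s)
    · exact Strand.map_eq₂₁ (D.seg _) (by rintro (_ | _ | _) <;> rfl)
    · exact Strand.map_eq₂₁ (D.seg _) (by rintro (_ | _ | _) <;> rfl)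
    · exact Strand.map_eq₂₁ (D.seg _) (by rintro (_ | _ | _) <;> rfl)
    · exact Strand.map_eq₂₁ (D.seg _) (by rintro (_ | _ | _) <;> rfl))
  (rightUnitor_naturality := fun f => by
    induction f using Quot.ind with | mk D => ?_
    refine ofEquiv_naturality _ _ _ _ (D.tensor (Cut.ofEquiv _ _)) D
      (Equiv.sumEmpty _ Empty).symm (Equiv.sumEmpty _ Empty).symm ?_
    rintro ((x | ⟨⟨⟩⟩) | y | j | s)
    · exact Strand.map_eq₂₁ (D.seg _) (by rintro (_ | _ | _) <;> rfl)
    · exact Strand.map_eq₂₁ (D.seg _) (by rintro (_ | _ | _) <;> rfl)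
    · exact Strand.map_eq₂₁ (D.seg _) (by rintro (_ | _ | _) <;> rfl)
    · exact Strand.map_eq₂₁ (D.seg _) (by rintro (_ | _ | _) <;> rfl))
  (pentagon := fun W X Y Z => by
    refine (comp_eq_ofEquiv (tensor_eq_ofEquiv rfl rfl)
      (comp_eq_ofEquiv rfl (tensor_eq_ofEquiv rfl rfl))).trans
      ((ofEquiv_congr ?_ ?_).trans (comp_eq_ofEquiv rfl rfl).symm) <;>
    rintro (((_ | _) | _) | _) <;> rfl)
  (triangle := fun X Y => by
    refine (comp_eq_ofEquiv rfl (tensor_eq_ofEquiv rfl rfl)).trans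
      ((ofEquiv_congr ?_ ?_).trans (tensor_eq_ofEquiv rfl rfl).symm) <;>
    rintro ((_ | ⟨⟨⟩⟩) | _) <;> rfl)

instance : SymmetricCategory (CobH A) where
  braiding X Y := isoOfEquiv (X := union X Y) (Y := union Y X) (Equiv.sumComm _ _)
    (Equiv.sumComm _ _)
  braiding_naturality_right X _ _ f := by
    induction f using Quot.ind with | mk D => ?_
    refine ofEquiv_naturality _ _ _ _ ((Cut.ofEquiv _ _).tensor D) (D.tensor (Cut.ofEquiv _ _))
      (Equiv.sumComm _ _) (Equiv.sumComm _ _) ?_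
    rintro ((x | x) | (y | y) | (j | ⟨⟨⟩⟩) | (s | ⟨⟨⟩⟩))
    · rfl
    · exact Strand.map_eq₂₂ (D.seg _) (by rintro (_ | _ | _) <;> rfl)
    · exact Strand.map_eq₂₂ (D.seg _) (by rintro (_ | _ | _) <;> rfl)
    · rfl
    · exact Strand.map_eq₂₂ (D.seg _) (by rintro (_ | _ | _) <;> rfl)
    · exact Strand.map_eq₂₂ (D.seg _) (by rintro (_ | _ | _) <;> rfl)
  braiding_naturality_left f Z := by
    induction f using Quot.ind with | mk D => ?_
    refine ofEquiv_naturality _ _ _ _ (D.tensor (Cut.ofEquiv _ _)) ((Cut.ofEquiv _ _).tensor D)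
      (Equiv.sumComm _ _) (Equiv.sumComm _ _) ?_
    rintro ((x | x) | (y | y) | (⟨⟨⟩⟩ | j) | (⟨⟨⟩⟩ | s))
    · exact Strand.map_eq₂₂ (D.seg _) (by rintro (_ | _ | _) <;> rfl)
    · rfl
    · rfl
    · exact Strand.map_eq₂₂ (D.seg _) (by rintro (_ | _ | _) <;> rfl)
    · exact Strand.map_eq₂₂ (D.seg _) (by rintro (_ | _ | _) <;> rfl)
    · exact Strand.map_eq₂₂ (D.seg _) (by rintro (_ | _ | _) <;> rfl)
  hexagon_forward X Y Z := by
    refine (comp_eq_ofEquiv rfl (comp_eq_ofEquiv rfl rfl)).trans ((ofEquiv_congr ?_ ?_).trans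
      (comp_eq_ofEquiv (tensor_eq_ofEquiv rfl rfl)
        (comp_eq_ofEquiv rfl (tensor_eq_ofEquiv rfl rfl))).symm) <;>
    rintro ((_ | _) | _) <;> rfl
  hexagon_reverse X Y Z := by
    refine (comp_eq_ofEquiv rfl (comp_eq_ofEquiv rfl rfl)).trans ((ofEquiv_congr ?_ ?_).trans
      (comp_eq_ofEquiv (tensor_eq_ofEquiv rfl rfl)
        (comp_eq_ofEquiv rfl (tensor_eq_ofEquiv rfl rfl))).symm) <;>
    rintro (_ | _ | _) <;> rfl
  symmetry X Y := by
    refine (comp_eq_ofEquiv rfl rfl).trans (ofEquiv_congr ?_ ?_) <;>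
    rintro (_ | _) <;> rfl

/-! ### Elementary cobordisms -/

/-- A positively oriented point. -/
def plus (A : Type u) : CobH A where
  pos := Unit
  neg := Empty

/-- A negatively oriented point. -/
def minus (A : Type u) : CobH A where
  pos := Empty
  neg := Unit

/-- The arc from `+` to `+`, oriented upwards, with defects that spell the word `w`. -/
def strand (w : List A) : plus A ⟶ plus A :=
  Quot.mk _ (
    { J := Empty
      S := Empty
      seg := fun
        | .bot _ => .fin w (.top ())
      matched := by
        rintro (⟨⟩ | ⟨⟨⟩⟩ | ⟨⟨⟩⟩)
        exact ⟨.bot (), rfl, by rintro (⟨⟩ | ⟨⟨⟩⟩ | ⟨⟨⟩⟩ | ⟨⟨⟩⟩) _; rfl⟩ } : Cut (plus A) (plus A))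

/-- The half-interval from an inner endpoint to `+` at the top, with the finite word `w`. -/
def halfIn (w : List A) : 𝟙_ (CobH A) ⟶ plus A :=
  Quot.mk _ (
    { J := Empty
      S := Unit
      seg := fun
        | .inner _ => .fin w (.top ())
      matched := by
        rintro (⟨⟩ | ⟨⟨⟩⟩ | ⟨⟨⟩⟩)
        exact ⟨.inner (), rfl, by rintro (⟨⟨⟩⟩ | ⟨⟨⟩⟩ | ⟨⟨⟩⟩ | ⟨⟩) _; rfl⟩ } : Cut (empty A) (plus A))

/-- The half-interval from `+` at the bottom to an inner endpoint, with the right-infinite word `ω`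
of defects, which accumulate towards the inner endpoint. -/
def halfOut (ω : Stream' A) : plus A ⟶ 𝟙_ (CobH A) :=
  Quot.mk _ (
    { J := Empty
      S := Empty
      seg := fun
        | .bot _ => .inf ω
      matched := by rintro (⟨⟨⟩⟩ | ⟨⟨⟩⟩ | ⟨⟨⟩⟩) } : Cut (plus A) (empty A))

/-- The arc without defects which enters at `+` and leaves at `-`, both at the bottom. -/
def cap (A : Type u) : minus A ⊗ plus A ⟶ 𝟙_ (CobH A) :=
  Quot.mk _ (
    { J := Empty
      S := Empty
      seg := fun
        | .bot (.inr _) => .fin [] (.bot (.inl ()))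
      matched := by
        rintro (⟨⟨⟩⟩ | (⟨⟩ | ⟨⟨⟩⟩) | ⟨⟨⟩⟩)
        exact ⟨.bot (.inr ()), rfl, by
          rintro ((⟨⟨⟩⟩ | ⟨⟩) | ⟨⟨⟩⟩ | ⟨⟨⟩⟩ | ⟨⟨⟩⟩) _; rfl⟩ } : Cut (union (minus A) (plus A)) (empty A))

/-- The arc without defects which enters at `-` and leaves at `+`, both at the top. -/
def cup (A : Type u) : 𝟙_ (CobH A) ⟶ plus A ⊗ minus A :=
  Quot.mk _ (
    { J := Empty
      S := Empty
      seg := fun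
        | .top (.inr _) => .fin [] (.top (.inl ()))
      matched := by
        rintro ((⟨⟩ | ⟨⟨⟩⟩) | ⟨⟨⟩⟩ | ⟨⟨⟩⟩)
        exact ⟨.top (.inr ()), rfl, by
          rintro (⟨⟨⟩⟩ | (⟨⟨⟩⟩ | ⟨⟩) | ⟨⟨⟩⟩ | ⟨⟨⟩⟩) _; rfl⟩ } : Cut (empty A) (union (plus A) (minus A)))

/-- The floating interval with the right-infinite word `ω`. -/
def interval (ω : Stream' A) : 𝟙_ (CobH A) ⟶ 𝟙_ (CobH A) :=
  Quot.mk _ (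
    { J := Empty
      S := Unit
      seg := fun
        | .inner _ => .inf ω
      matched := by rintro (⟨⟨⟩⟩ | ⟨⟨⟩⟩ | ⟨⟨⟩⟩) } : Cut (empty A) (empty A))

/-- The floating circle with the circular word `w`. -/
def circle (w : List A) : 𝟙_ (CobH A) ⟶ 𝟙_ (CobH A) :=
  Quot.mk _ (
    { J := Unit
      S := Empty
      seg := fun
        | .cut _ => .fin w (.cut ())
      matched := by
        rintro (⟨⟨⟩⟩ | ⟨⟨⟩⟩ | ⟨⟩)
        exact ⟨.cut (), rfl, by rintro (⟨⟨⟩⟩ | ⟨⟨⟩⟩ | ⟨⟩ | ⟨⟨⟩⟩) _; rfl⟩ } : Cut (empty A) (empty A))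

end CobH

/-! ## Büchi quasi-automata -/

/-- A Büchi quasi-automaton over the alphabet `A`: a finitely generated projective `𝔹`-semimodule
with an endomorphism for each letter, an initial vector and a covector. -/
structure BuchiQuasiAutomaton (A : Type u) where
  /-- the underlying semimodule -/
  P : Type
  [addCommMonoid : AddCommMonoid P]
  [module : Module BoolSR P]
  [finite : Module.Finite BoolSR P]
  [projective : Module.Projective BoolSR P]
  /-- the action of the letters -/
  m : A → P →ₗ[BoolSR] P
  /-- the initial vector -/
  init : P
  /-- the covector -/
  b : P →ₗ[BoolSR] BoolSR

attribute [instance] BuchiQuasiAutomaton.addCommMonoid BuchiQuasiAutomaton.module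
  BuchiQuasiAutomaton.finite BuchiQuasiAutomaton.projective

namespace BuchiQuasiAutomaton

variable {A : Type u} (Q : BuchiQuasiAutomaton A)

/-- The right action `x ↦ x a₁ ⋯ aₙ` of a finite word; the first letter acts first. -/
def act : List A → Q.P →ₗ[BoolSR] Q.P
  | [] => LinearMap.id
  | a :: w => act w ∘ₗ Q.m a

/-- Started at `x`, the right-infinite word `ω = a₁ a₂ ⋯` satisfies the Büchi condition:
`b (x a₁ ⋯ aₙ) = 1` for infinitely many `n > 0`. -/
def AcceptsFrom (x : Q.P) (ω : Stream' A) : Prop :=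
  {n : ℕ | 0 < n ∧ Q.b (Q.act (ω.take n) x) = 1}.Infinite

/-- The `ω`-language of a Büchi quasi-automaton. -/
def language : Set (Stream' A) := {ω | Q.AcceptsFrom Q.init ω}

end BuchiQuasiAutomaton

/-! ## Values of a TQFT -/

/-- The linear map underlying a morphism of projective `𝔹`-semimodules. -/
def BoolPMod.lin {M N : BoolPMod} (f : M ⟶ N) : M.obj →ₗ[BoolSR] N.obj := f.hom.hom

section values

variable {A : Type u} (F : CobH A ⥤ BoolPMod) [F.Braided] {X : CobH A}

/-- The vector of `F(X)` given by a cobordism from the empty `0`-manifold to `X`. -/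
def tqftVec (f : 𝟙_ (CobH A) ⟶ X) : (F.obj X).obj :=
  BoolPMod.lin (Functor.LaxMonoidal.ε F ≫ F.map f) (1 : BoolSR)

/-- The covector on `F(X)` given by a cobordism from `X` to the empty `0`-manifold. -/
def tqftCovec (f : X ⟶ 𝟙_ (CobH A)) : (F.obj X).obj →ₗ[BoolSR] BoolSR :=
  BoolPMod.lin (F.map f ≫ Functor.OplaxMonoidal.η F)

/-- The value of a closed cobordism. -/
def tqftEval (f : 𝟙_ (CobH A) ⟶ 𝟙_ (CobH A)) : BoolSR := tqftCovec F f (tqftVec F (𝟙 _))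

/-- The tensor `x ⊗ y` as a vector of `F(X ⊔ Y)`. -/
def tqftTensor {Y : CobH A} (x : (F.obj X).obj) (y : (F.obj Y).obj) : (F.obj (X ⊗ Y)).obj :=
  BoolPMod.lin (Functor.LaxMonoidal.μ F X Y) (x ⊗ₜ[BoolSR] y)

/-- A vector of `F(X ⊔ Y)` as an element of `F(X) ⊗ F(Y)`. -/
def tqftSplit {Y : CobH A} (z : (F.obj (X ⊗ Y)).obj) : (F.obj X).obj ⊗[BoolSR] (F.obj Y).obj :=
  BoolPMod.lin (Functor.OplaxMonoidal.δ F X Y) z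

end values

/-! The functor is a state sum. Since `P` is finitely generated and projective, there are vectors
`x_i` and covectors `f_i` with `v = ∑ f_i(v) x_i` for all `v`. Label the boundary points and the cut
points of a cobordism by indices. A segment with word `w` from label `i` to label `j` gets the
weight `f_j(x_i w)`. At an inner endpoint the initial vector replaces `x_i`, and on a segment with a
right-infinite word `γ_ω` replaces `f_j` and `w`. In `𝔹` a sum is "there exists" and a product is
"and", so a cobordism yields a relation between labellings of its source and of its target: the cut
points can be labelled so that all weights are `1`. That `γ_ω` is linear at all is due to `1 + 1 =
1`: a union of two sets is infinite iff one of them is.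

The relation does not depend on the cut points, because erasing one amounts to `∑ f_k(v) ξ(x_k) =
ξ(v)` (`stateSum_of_erase`). Gluing composes relations (`rel_comp`), since the glued points become
labelled cut points, and disjoint union multiplies them (`rel_tensor`).

The `x_i` need not form a basis, so the cylinder acts by an idempotent that may differ from the
identity. The value of the functor on `X` is the set of functions on labellings fixed by this
idempotent, a retract of a finite free semimodule. Idempotents multiply under disjoint union, hence
so do the fixed spaces (`mulEquiv`). Permutation cobordisms act on fixed functions by mere
relabelling (`cobMap_ofEquiv`), so coherence reduces to the monoid laws of multiplication in `𝔹`.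

On `+` the fixed space is `P` via `v ↦ ∑ v_i x_i`, and on `-` it is `P*` via `v ↦ ∑ v_i f_i`. The
required values are then read off from cobordisms with a single segment. The circle gives `∑ f_i(x_i
w)`, which equals the contraction of every tensor representing `m_w` (`sum_dualTensorHom`). -/

namespace BoolSR

/-! ### Boolean arithmetic as logic -/

theorem zero_ne_one : (0 : BoolSR) ≠ 1 := by
  intro h
  cases h

/-- Turns every equality of state sums into an equivalence of propositions. -/
theorem ext_one {x y : BoolSR} (h : x = 1 ↔ y = 1) : x = y := by
  rcases x with _ | _ <;> rcases y with _ | _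
  · rfl
  · exact h.2 rfl
  · exact (h.1 rfl).symm
  · rfl

@[simp] theorem add_eq_one {x y : BoolSR} : x + y = 1 ↔ x = 1 ∨ y = 1 := by
  revert x y
  rintro (_ | _) (_ | _)
  · exact ⟨.inl, fun h => h.elim id id⟩
  · exact ⟨.inr, fun _ => rfl⟩
  · exact ⟨fun _ => .inl rfl, fun _ => rfl⟩
  · exact ⟨fun _ => .inl rfl, fun _ => rfl⟩

@[simp] theorem mul_eq_one {x y : BoolSR} : x * y = 1 ↔ x = 1 ∧ y = 1 := by
  revert x y
  rintro (_ | _) (_ | _)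
  · exact ⟨fun h => ⟨h, h⟩, fun h => h.1⟩
  · exact ⟨fun h => ⟨h, rfl⟩, fun h => h.1⟩
  · exact ⟨fun h => ⟨rfl, h⟩, fun h => h.2⟩
  · exact ⟨fun _ => ⟨rfl, rfl⟩, fun _ => rfl⟩

@[simp] theorem sum_eq_one {ι : Type*} {s : Finset ι} {f : ι → BoolSR} :
    ∑ i ∈ s, f i = 1 ↔ ∃ i ∈ s, f i = 1 := by
  classical
  induction s using Finset.induction_on with
  | empty => simp [zero_ne_one]
  | insert a s ha ih => simp [Finset.sum_insert ha, ih]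

open Classical in
/-- The truth value of a proposition. -/
noncomputable def ofProp (p : Prop) : BoolSR := if p then 1 else 0

@[simp] theorem ofProp_eq_one {p : Prop} : ofProp p = 1 ↔ p := by
  unfold ofProp
  split_ifs with h
  · simp [h]
  · simp only [h]

/-- The linear map given by a relation. -/
noncomputable def relMap {α β : Type*} (R : α → β → Prop) :
    (α → BoolSR) →ₗ[BoolSR] (β → BoolSR) where
  toFun f b := ofProp (∃ a, f a = 1 ∧ R a b)
  map_add' f g := by
    funext b
    refine ext_one ?_
    simp [or_and_right, exists_or]
  map_smul' r f := by
    funext b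
    refine ext_one ?_
    simp [and_assoc]

theorem relMap_apply_eq_one {α β : Type*} {R : α → β → Prop} {f : α → BoolSR} {b : β} :
    relMap R f b = 1 ↔ ∃ a, f a = 1 ∧ R a b := ofProp_eq_one

/-- Over `𝔹` the matrix product is composition of relations. -/
theorem relMap_relMap {α β γ : Type*} {R : α → β → Prop} {S : β → γ → Prop} {T : α → γ → Prop}
    (h : ∀ a c, T a c ↔ ∃ b, R a b ∧ S b c) (f : α → BoolSR) :
    relMap S (relMap R f) = relMap T f := by
  funext c
  refine ext_one ?_
  simp only [relMap_apply_eq_one, h]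
  constructor
  · rintro ⟨b, ⟨a, h1, h2⟩, h3⟩
    exact ⟨a, h1, b, h2, h3⟩
  · rintro ⟨a, h1, b, h2, h3⟩
    exact ⟨b, ⟨a, h1, h2⟩, h3⟩

end BoolSR

/-! ### Finite resolutions of the identity and the trace -/

/-- A finite family of vectors and covectors which resolves the identity. -/
structure DualFrame (P : Type) [AddCommMonoid P] [Module BoolSR P] where
  /-- the number of vectors -/
  n : ℕ
  /-- the vectors -/
  vec : Fin n → P
  /-- the covectors -/
  covec : Fin n → P →ₗ[BoolSR] BoolSR
  sum_smul : ∀ v, ∑ i, covec i v • vec i = v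

namespace DualFrame

variable {P : Type} [AddCommMonoid P] [Module BoolSR P]

/-- A surjection `𝔹ⁿ → P` splits by projectivity. The vectors are the images of the standard basis,
the covectors the coordinates of the section. -/
theorem exists_of_projective [Module.Finite BoolSR P] [Module.Projective BoolSR P] :
    Nonempty (DualFrame P) := by
  obtain ⟨n, f, hf⟩ := Module.Finite.exists_fin' BoolSR P
  obtain ⟨g, hg⟩ := Module.projective_lifting_property f LinearMap.id hf
  refine ⟨⟨n, fun i => f (Pi.single i 1), fun i => LinearMap.proj i ∘ₗ g, fun v => ?_⟩⟩
  have h : f (g v) = v := LinearMap.congr_fun hg v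
  conv_rhs => rw [← h, pi_eq_sum_univ' (g v), map_sum]
  refine Finset.sum_congr rfl fun i _ => ?_
  rw [LinearMap.map_smul]
  rfl

variable (B : DualFrame P)

theorem sum_mul (ξ : P →ₗ[BoolSR] BoolSR) (v : P) :
    ∑ i, B.covec i v * ξ (B.vec i) = ξ v := by
  conv_rhs => rw [← B.sum_smul v, map_sum]
  simp

/-- The algebraic form of cutting a segment: the index `i` is the label of the new cut point. -/
theorem apply_eq_one (ξ : P →ₗ[BoolSR] BoolSR) (v : P) :
    ξ v = 1 ↔ ∃ i, B.covec i v = 1 ∧ ξ (B.vec i) = 1 := by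
  rw [← B.sum_mul ξ v]
  simp

theorem ext_covec {v v' : P} (h : ∀ i, B.covec i v = B.covec i v') : v = v' := by
  rw [← B.sum_smul v, ← B.sum_smul v']
  simp [h]

/-- For `ξ ⊗ y` the left side is `∑ ξ(x_i) f_i(y) = ξ(y)`, and both sides are additive. Hence the
trace computed in the frame depends neither on the frame nor on the tensor chosen to represent the
endomorphism. -/
theorem sum_dualTensorHom (t : Module.Dual BoolSR P ⊗[BoolSR] P) :
    ∑ i, B.covec i (dualTensorHom BoolSR P P t (B.vec i)) = contractLeft BoolSR P t := by
  induction t with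
  | zero => simp
  | tmul ξ y =>
    rw [contractLeft_apply, ← B.sum_mul ξ y]
    simp [dualTensorHom_apply, mul_comm]
  | add s t hs ht => simp [Finset.sum_add_distrib, hs, ht]

end DualFrame

/-! ### The Büchi condition as a covector -/

namespace BuchiQuasiAutomaton

variable {A : Type u} (Q : BuchiQuasiAutomaton A)

theorem act_append (w v : List A) (x : Q.P) : Q.act (w ++ v) x = Q.act v (Q.act w x) := by
  induction w generalizing x with
  | nil => rfl
  | cons a w ih => exact ih (Q.m a x)

/-- The accepting times of `x + y` are the union of those of `x` and of `y`, and a union of two sets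
is infinite iff one of them is. -/
theorem acceptsFrom_add (x y : Q.P) (ω : Stream' A) :
    Q.AcceptsFrom (x + y) ω ↔ Q.AcceptsFrom x ω ∨ Q.AcceptsFrom y ω := by
  unfold AcceptsFrom
  rw [← Set.infinite_union]
  congr! 1
  ext n
  simp [and_or_left]

theorem not_acceptsFrom_zero (ω : Stream' A) : ¬ Q.AcceptsFrom 0 ω := by
  simp [AcceptsFrom, BoolSR.zero_ne_one]

theorem acceptsFrom_cons (a : A) (ω : Stream' A) (x : Q.P) :
    Q.AcceptsFrom x (Stream'.cons a ω) ↔ Q.AcceptsFrom (Q.m a x) ω := by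
  unfold AcceptsFrom
  constructor
  · intro h hf
    -- Accepting times shift by one. Time `1` is inserted because it corresponds to time `0` after
    -- the letter `a`, which the condition `0 < n` discards.
    refine h (((hf.image Nat.succ).insert 1).subset ?_)
    rintro (_ | _ | n) ⟨h0, hn⟩
    · exact absurd h0 (lt_irrefl _)
    · exact .inl rfl
    · exact .inr ⟨n + 1, ⟨Nat.succ_pos _, hn⟩, rfl⟩
  · intro h
    refine (h.image Nat.succ_injective.injOn).mono ?_
    rintro _ ⟨n, ⟨_, hn⟩, rfl⟩
    exact ⟨Nat.succ_pos _, hn⟩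

/-- This is `γ_{wω} = γ_ω ∘ m_w`, which lets a cut point on a component with a right-infinite word
be moved or erased. -/
theorem acceptsFrom_append (w : List A) (ω : Stream' A) (x : Q.P) :
    Q.AcceptsFrom x (w ++ₛ ω) ↔ Q.AcceptsFrom (Q.act w x) ω := by
  induction w generalizing x with
  | nil => rfl
  | cons a w ih => exact (Q.acceptsFrom_cons a _ x).trans (ih _)

/-- The covector which tests the Büchi condition for a right-infinite word. -/
noncomputable def acceptCovec (ω : Stream' A) : Q.P →ₗ[BoolSR] BoolSR where
  toFun x := BoolSR.ofProp (Q.AcceptsFrom x ω)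
  map_add' x y := BoolSR.ext_one (by simp [acceptsFrom_add])
  map_smul' r x := by
    refine BoolSR.ext_one ?_
    rcases r with _ | _
    · have h : BoolSR.zero • x = 0 := zero_smul BoolSR x
      simp only [h, BoolSR.ofProp_eq_one, not_acceptsFrom_zero, false_iff]
      exact fun h => BoolSR.zero_ne_one (BoolSR.mul_eq_one.1 h).1
    · have h : BoolSR.one • x = x := one_smul BoolSR x
      rw [h]
      exact Iff.rfl

theorem acceptCovec_eq_one (ω : Stream' A) (x : Q.P) :
    Q.acceptCovec ω x = 1 ↔ Q.AcceptsFrom x ω := BoolSR.ofProp_eq_one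

end BuchiQuasiAutomaton

namespace DualFrame

variable {A : Type u} {Q : BuchiQuasiAutomaton A} (B : DualFrame Q.P)

/-! ### The weight of a segment -/

/-- The covector given by a segment whose possible end points are labelled by indices. -/
noncomputable def strandCovec {H : Type} (lab : H → Fin B.n) :
    Strand A H → (Q.P →ₗ[BoolSR] BoolSR)
  | .fin w h => B.covec (lab h) ∘ₗ Q.act w
  | .inf ω => Q.acceptCovec ω

theorem strandCovec_map {H H' : Type} (lab : H' → Fin B.n) (f : H → H') (s : Strand A H) :
    B.strandCovec lab (s.map f) = B.strandCovec (lab ∘ f) s := by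
  cases s <;> rfl

theorem strandCovec_map_apply {H H' : Type} {lab : H' → Fin B.n} {lab' : H → Fin B.n} {f : H → H'}
    {s : Strand A H} {x x' : Q.P} (hl : ∀ h, lab (f h) = lab' h) (hx : x = x') :
    B.strandCovec lab (s.map f) x = B.strandCovec lab' s x' := by
  rw [strandCovec_map, hx, show lab ∘ f = lab' from funext hl]

/-- Weights are compatible with concatenation: `m_{wv} = m_v ∘ m_w` for finite words, and `γ_{wω} =
γ_ω ∘ m_w` for infinite ones. -/
theorem strandCovec_prepend {H : Type} (lab : H → Fin B.n) (w : List A) (s : Strand A H) (x : Q.P) :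
    B.strandCovec lab (s.prepend w) x = B.strandCovec lab s (Q.act w x) := by
  cases s with
  | fin v h => exact congrArg (B.covec (lab h)) (Q.act_append w v x)
  | inf ω =>
    refine BoolSR.ext_one ?_
    simp only [Strand.prepend, strandCovec, Q.acceptCovec_eq_one]
    exact Q.acceptsFrom_append w ω x

/-! ### The state sum -/

/-- Labellings of the points of a `0`-manifold. -/
abbrev Lab (X : CobH A) : Type := (X.pos → Fin B.n) × (X.neg → Fin B.n)

section

variable {X Y Z : CobH A} {J S : Type}

/-- The vector at the beginning of a segment. -/
def tailVec (a : B.Lab X) (c : B.Lab Y) (j : J → Fin B.n) : CobH.Tail X Y J S → Q.P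
  | .bot x => B.vec (a.1 x)
  | .top y => B.vec (c.2 y)
  | .cut k => B.vec (j k)
  | .inner _ => Q.init

/-- The label at the end of a segment. -/
def headLab (a : B.Lab X) (c : B.Lab Y) (j : J → Fin B.n) : CobH.Head X Y J → Fin B.n
  | .top y => c.1 y
  | .bot x => a.2 x
  | .cut k => j k

/-- The state sum of a family of segments: the cut points can be labelled in such a way that all
segments have weight `1`. -/
def StateSum (seg : CobH.Tail X Y J S → Strand A (CobH.Head X Y J)) (a : B.Lab X) (c : B.Lab Y) :
    Prop :=
  ∃ j : J → Fin B.n, ∀ t, B.strandCovec (B.headLab a c j) (seg t) (B.tailVec a c j t) = 1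

theorem headLab_map {J' : Type} (a : B.Lab X) (c : B.Lab Y) (j : J → Fin B.n) (r : J' → J) :
    B.headLab a c j ∘ CobH.Head.map r = B.headLab a c (j ∘ r) := by
  funext h
  cases h <;> rfl

theorem tailVec_map {J' S' : Type} (a : B.Lab X) (c : B.Lab Y) (j : J → Fin B.n) (r : J' → J)
    (e : S' → S) (t : CobH.Tail X Y J' S') :
    B.tailVec a c j (t.map r e) = B.tailVec a c (j ∘ r) t := by
  cases t <;> rfl

/-- The easy half of the invariance: if both segments at an erased point have weight `1`, its label
is the witness that their concatenation has weight `1`. -/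
theorem strandCovec_pass_of_stateSum {seg : CobH.Tail X Y J S → Strand A (CobH.Head X Y J)}
    {a : B.Lab X} {c : B.Lab Y} {j : J → Fin B.n}
    (hj : ∀ t, B.strandCovec (B.headLab a c j) (seg t) (B.tailVec a c j t) = 1) (R : Set J)
    (s : Strand A (CobH.Head X Y J)) (x : Q.P) (hs : B.strandCovec (B.headLab a c j) s x = 1) :
    B.strandCovec (B.headLab a c j) (s.bind (CobH.pass seg R)) x = 1 := by
  cases s with
  | inf ω => exact hs
  | fin w h =>
    refine (B.strandCovec_prepend _ w _ x).trans ?_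
    rcases h with y | y | k
    · exact hs
    · exact hs
    · by_cases hk : k ∈ R
      · rw [CobH.pass_of_mem _ hk]
        exact hs
      · rw [CobH.pass_of_not_mem _ hk]
        exact (B.apply_eq_one _ _).2 ⟨j k, hs, hj (.cut k)⟩

/-- Only the label at the end of the segment enters its covector; with an infinite word none does.
-/
theorem strandCovec_congr {H : Type} {lab lab' : H → Fin B.n} {s : Strand A H}
    (h : ∀ x, s.head? = some x → lab x = lab' x) :
    B.strandCovec lab s = B.strandCovec lab' s := by
  cases s with
  | fin w k => simp only [strandCovec, h k rfl]
  | inf ω => rfl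

/-- A labelling of the finer cobordism restricts to the kept points. Conversely, a labelling of the
coarser one extends over each erased point separately by splitting the weight of the joined segment
with `apply_eq_one`. The choices do not interfere, because no segment joins two erased points. -/
theorem stateSum_of_erase {D D' : CobH.Cut X Y} (h : CobH.Erase D D') (a : B.Lab X) (c : B.Lab Y) :
    B.StateSum D.seg a c ↔ B.StateSum D'.seg a c := by
  obtain ⟨r, e, hr, hi, hs⟩ := h
  constructor
  · rintro ⟨j, hj⟩
    refine ⟨j ∘ r, fun t => ?_⟩
    rw [← B.headLab_map, ← B.strandCovec_map, ← hs, ← B.tailVec_map a c j r e]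
    exact B.strandCovec_pass_of_stateSum hj _ _ _ (hj _)
  · rintro ⟨j', hj'⟩
    have kept : ∀ t : CobH.Tail X Y D.J D.S, (∃ t', CobH.Tail.map r e t' = t) ∨
        ∃ k ∉ Set.range r, t = .cut k := by
      rintro (x | y | k | s)
      · exact .inl ⟨.bot x, rfl⟩
      · exact .inl ⟨.top y, rfl⟩
      · by_cases hk : k ∈ Set.range r
        · obtain ⟨k', rfl⟩ := hk
          exact .inl ⟨.cut k', rfl⟩
        · exact .inr ⟨k, hk, rfl⟩
      · exact .inl ⟨.inner (e.symm s), congrArg _ (e.apply_symm_apply s)⟩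
    -- the label of an erased point is chosen on the unique segment that runs into it
    have ex : ∀ k : D.J, ∃ i : Fin B.n, (∀ k', r k' = k → i = j' k') ∧
        (k ∉ Set.range r → ∀ t' w, D.seg (CobH.Tail.map r e t') = .fin w (.cut k) →
          B.covec i (Q.act w (B.tailVec a c j' t')) = 1 ∧
          ∀ j, j ∘ r = j' →
            B.strandCovec (B.headLab a c j) (D.seg (.cut k)) (B.vec i) = 1) := by
      intro k
      by_cases hk : k ∈ Set.range r
      · obtain ⟨k', rfl⟩ := hk
        exact ⟨j' k', fun k'' h => by rw [hr h], fun h => absurd ⟨k', rfl⟩ h⟩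
      · obtain ⟨t, ht, hu⟩ := D.matched (.cut k)
        rcases kept t with ⟨t', rfl⟩ | ⟨k₀, hk₀, rfl⟩
        · obtain ⟨w, hw⟩ : ∃ w, D.seg (CobH.Tail.map r e t') = .fin w (.cut k) := by
            cases hseg : D.seg (CobH.Tail.map r e t') with
            | fin w h =>
              rw [hseg] at ht
              exact ⟨w, by rw [Option.some_injective _ ht]⟩
            | inf ω =>
              rw [hseg] at ht
              cases ht
          have hval := hj' t'
          -- The joined segment factors at `k` as the word `w` followed by the segment that begins
          -- at `k`.
          have key : ∀ j, j ∘ r = j' → B.strandCovec (B.headLab a c j') (D'.seg t') =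
              B.strandCovec (B.headLab a c j) (D.seg (.cut k)) ∘ₗ Q.act w := by
            intro j hjr
            rw [← hjr, ← B.headLab_map, ← B.strandCovec_map, ← hs, hw]
            refine LinearMap.ext fun x => ?_
            refine (B.strandCovec_prepend _ w _ x).trans ?_
            rw [CobH.pass_of_not_mem _ hk]
            rfl
          -- The segment that begins at `k` does not run into an erased point, so its weight is
          -- determined by `j'` alone. This permits choosing the label of `k` before the labels of
          -- the other erased points are known.
          have indep : ∀ j₁ j₂, j₁ ∘ r = j' → j₂ ∘ r = j' →
              B.strandCovec (B.headLab a c j₁) (D.seg (.cut k)) =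
                B.strandCovec (B.headLab a c j₂) (D.seg (.cut k)) := by
            intro j₁ j₂ h₁ h₂
            refine B.strandCovec_congr fun x hx => ?_
            rcases x with y | y | l
            · rfl
            · rfl
            · by_cases hl : l ∈ Set.range r
              · obtain ⟨l', rfl⟩ := hl
                exact congrFun (h₁.trans h₂.symm) l'
              · exact absurd hx (hi k hk l hl)
          -- Some extension of `j'` to all cut points is needed to state the weight of the outgoing
          -- segment; the values at erased points are arbitrary.
          have hn : Nonempty (D.J → Fin B.n) → ∃ j : D.J → Fin B.n, j ∘ r = j' := by
            rintro ⟨j₀⟩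
            exact ⟨Function.extend r j' j₀, funext fun x => hr.extend_apply j' j₀ x⟩
          by_cases hne : Nonempty (Fin B.n)
          · obtain ⟨j, hjr⟩ := hn ⟨fun _ => hne.some⟩
            rw [key j hjr, LinearMap.comp_apply, B.apply_eq_one] at hval
            obtain ⟨i, hi1, hi2⟩ := hval
            refine ⟨i, fun k' h => absurd ⟨k', h⟩ hk, fun _ t'' w' h => ?_⟩
            have htt := hu _ ((congrArg Strand.head? h).trans rfl)
            -- By matching only one segment runs into `k`, and renaming of tails is injective
            -- because `r` and `e` are.
            have hinj : t'' = t' := by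
              rcases t'' with _ | _ | _ | _ <;> rcases t' with _ | _ | _ | _ <;>
                simp only [CobH.Tail.map, CobH.Tail.bot.injEq, CobH.Tail.top.injEq,
                  CobH.Tail.cut.injEq, CobH.Tail.inner.injEq, reduceCtorEq] at htt
              · rw [htt]
              · rw [htt]
              · rw [hr htt]
              · rw [e.injective htt]
            subst hinj
            rw [hw] at h
            cases h
            exact ⟨hi1, fun j₂ h₂ => by rw [indep j₂ j h₂ hjr]; exact hi2⟩
          -- Without indices the frame resolves the identity by an empty sum, so `P = 0` and no
          -- weight can be `1`.
          · have hz : B.tailVec a c j' t' = 0 := by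
              rw [← B.sum_smul (B.tailVec a c j' t')]
              exact Finset.sum_eq_zero fun i _ => absurd ⟨i⟩ hne
            rw [hz, map_zero] at hval
            exact absurd hval BoolSR.zero_ne_one
        · exact absurd ht (hi k₀ hk₀ k hk)
    choose j hj1 hj2 using ex
    have hjr : j ∘ r = j' := funext fun k => hj1 _ k rfl
    -- Segments that begin at a kept tail have weight `1`: if one runs into an erased point, this is
    -- how the label there was chosen; otherwise the segment is unchanged.
    have main : ∀ t', B.strandCovec (B.headLab a c j) (D.seg (CobH.Tail.map r e t'))
        (B.tailVec a c j' t') = 1 := by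
      intro t'
      have hval := hj' t'
      rw [← hjr, ← B.headLab_map, ← B.strandCovec_map, ← hs, hjr] at hval
      cases hseg : D.seg (CobH.Tail.map r e t') with
      | inf ω =>
        rw [hseg] at hval
        exact hval
      | fin w h =>
        rw [hseg] at hval
        have hval := (B.strandCovec_prepend _ w _ _).symm.trans hval
        rcases h with y | y | k
        · exact hval
        · exact hval
        · by_cases hk : k ∈ Set.range r
          · rw [CobH.pass_of_mem _ hk] at hval
            exact hval
          · exact (hj2 k hk t' w hseg).1
    refine ⟨j, fun t => ?_⟩
    rcases kept t with ⟨t', rfl⟩ | ⟨k, hk, rfl⟩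
    · rw [B.tailVec_map, hjr]
      exact main t'
    -- For the segment that begins at an erased point, the label was chosen together with the
    -- segment running into that point, which must begin at a kept tail.
    · obtain ⟨t, ht, -⟩ := D.matched (.cut k)
      rcases kept t with ⟨t', rfl⟩ | ⟨k₀, hk₀, rfl⟩
      · cases hseg : D.seg (CobH.Tail.map r e t') with
        | fin w h =>
          rw [hseg] at ht
          cases Option.some_injective _ ht
          exact (hj2 k hk t' w hseg).2 j hjr
        | inf ω =>
          rw [hseg] at ht
          cases ht
      · exact absurd ht (hi k₀ hk₀ k hk)

/-! ### Relations of cobordisms: gluing, disjoint union, permutations -/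

/-- The relation between labellings given by a cobordism. -/
def rel (f : CobH.Mor X Y) : B.Lab X → B.Lab Y → Prop :=
  Quot.lift (fun D : CobH.Cut X Y => B.StateSum D.seg)
    (fun _ _ h => funext fun a => funext fun c => propext (B.stateSum_of_erase h a c)) f

/-- A labelling of the cut points of the glued cobordism consists of labellings of the old cut
points of both pieces and one of `Y`. The latter is the intermediate labelling `b`. -/
theorem rel_comp (f : CobH.Mor X Y) (g : CobH.Mor Y Z) (a : B.Lab X) (c : B.Lab Z) :
    B.rel (f.comp g) a c ↔ ∃ b, B.rel f a b ∧ B.rel g b c := by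
  induction f using Quot.ind with | mk D => ?_
  induction g using Quot.ind with | mk E => ?_
  have hl : ∀ (j₁ : D.J → Fin B.n) (b : B.Lab Y) (j₂ : E.J → Fin B.n) (t : CobH.Tail X Y D.J D.S),
      B.strandCovec (B.headLab a c (Sum.elim j₁ (Sum.elim (Sum.elim b.1 b.2) j₂)))
        ((D.comp E).seg (CobH.tailL t))
        (B.tailVec a c (Sum.elim j₁ (Sum.elim (Sum.elim b.1 b.2) j₂))
          (CobH.tailL (S₂ := E.S) t)) =
      B.strandCovec (B.headLab a b j₁) (D.seg t) (B.tailVec a b j₁ t) := by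
    intro j₁ b j₂ t
    exact (congrArg₂ (fun s x => B.strandCovec _ s x) (CobH.compSeg_tailL D.seg E.seg t) rfl).trans
      (B.strandCovec_map_apply (by rintro (_ | _ | _) <;> rfl) (by cases t <;> rfl))
  have hr : ∀ (j₁ : D.J → Fin B.n) (b : B.Lab Y) (j₂ : E.J → Fin B.n) (t : CobH.Tail Y Z E.J E.S),
      B.strandCovec (B.headLab a c (Sum.elim j₁ (Sum.elim (Sum.elim b.1 b.2) j₂)))
        ((D.comp E).seg (CobH.tailR t))
        (B.tailVec a c (Sum.elim j₁ (Sum.elim (Sum.elim b.1 b.2) j₂)) (CobH.tailR (S₁ := D.S) t)) =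
      B.strandCovec (B.headLab b c j₂) (E.seg t) (B.tailVec b c j₂ t) := by
    intro j₁ b j₂ t
    exact (congrArg₂ (fun s x => B.strandCovec _ s x) (CobH.compSeg_tailR D.seg E.seg t) rfl).trans
      (B.strandCovec_map_apply (by rintro (_ | _ | _) <;> rfl) (by cases t <;> rfl))
  constructor
  · rintro ⟨j, hj⟩
    obtain ⟨j₁, b, j₂, rfl⟩ : ∃ (j₁ : D.J → Fin B.n) (b : B.Lab Y) (j₂ : E.J → Fin B.n),
        j = Sum.elim j₁ (Sum.elim (Sum.elim b.1 b.2) j₂) :=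
      ⟨fun k => j (.inl k), (fun y => j (.inr (.inl (.inl y))), fun y => j (.inr (.inl (.inr y)))),
        fun k => j (.inr (.inr k)), funext (by rintro (_ | (_ | _) | _) <;> rfl)⟩
    exact ⟨b, ⟨j₁, fun t => (hl j₁ b j₂ t).symm.trans (hj _)⟩,
      ⟨j₂, fun t => (hr j₁ b j₂ t).symm.trans (hj _)⟩⟩
  · rintro ⟨b, ⟨j₁, h₁⟩, ⟨j₂, h₂⟩⟩
    refine ⟨Sum.elim j₁ (Sum.elim (Sum.elim b.1 b.2) j₂), fun t => ?_⟩
    rcases CobH.comp_cover t with ⟨t, rfl⟩ | ⟨t, rfl⟩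
    · exact (hl j₁ b j₂ t).trans (h₁ t)
    · exact (hr j₁ b j₂ t).trans (h₂ t)

variable {X₁ Y₁ X₂ Y₂ : CobH A}

/-- The restriction of a labelling to the first part of a disjoint union. -/
def Lab.fst {B : DualFrame Q.P} (a : B.Lab (CobH.union X₁ X₂)) : B.Lab X₁ :=
  (fun x => a.1 (.inl x), fun x => a.2 (.inl x))

/-- The restriction of a labelling to the second part of a disjoint union. -/
def Lab.snd {B : DualFrame Q.P} (a : B.Lab (CobH.union X₁ X₂)) : B.Lab X₂ :=
  (fun x => a.1 (.inr x), fun x => a.2 (.inr x))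

/-- Labellings of the two parts of a disjoint union. -/
def Lab.pair {B : DualFrame Q.P} (a : B.Lab X₁) (b : B.Lab X₂) : B.Lab (CobH.union X₁ X₂) :=
  (Sum.elim a.1 b.1, Sum.elim a.2 b.2)

theorem Lab.pair_fst_snd {B : DualFrame Q.P} (a : B.Lab (CobH.union X₁ X₂)) :
    Lab.pair a.fst a.snd = a :=
  Prod.ext (funext (by rintro (_ | _) <;> rfl)) (funext (by rintro (_ | _) <;> rfl))

/-- No segment joins the two parts, so labellings of the cut points are chosen independently. -/
theorem rel_tensor (f : CobH.Mor X₁ Y₁) (g : CobH.Mor X₂ Y₂) (a : B.Lab (CobH.union X₁ X₂))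
    (c : B.Lab (CobH.union Y₁ Y₂)) :
    B.rel (f.tensor g) a c ↔ B.rel f a.fst c.fst ∧ B.rel g a.snd c.snd := by
  induction f using Quot.ind with | mk D => ?_
  induction g using Quot.ind with | mk E => ?_
  have hl : ∀ (j₁ : D.J → Fin B.n) (j₂ : E.J → Fin B.n) (t : CobH.Tail X₁ Y₁ D.J D.S),
      B.strandCovec (B.headLab a c (Sum.elim j₁ j₂)) ((D.tensor E).seg (CobH.tailInl t))
        (B.tailVec a c (Sum.elim j₁ j₂) (CobH.tailInl (S₂ := E.S) t)) =
      B.strandCovec (B.headLab a.fst c.fst j₁) (D.seg t) (B.tailVec a.fst c.fst j₁ t) := by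
    intro j₁ j₂ t
    exact (congrArg₂ (fun s x => B.strandCovec _ s x) (CobH.tensorSeg_inl D.seg E.seg t) rfl).trans
      (B.strandCovec_map_apply (by rintro (_ | _ | _) <;> rfl) (by cases t <;> rfl))
  have hr : ∀ (j₁ : D.J → Fin B.n) (j₂ : E.J → Fin B.n) (t : CobH.Tail X₂ Y₂ E.J E.S),
      B.strandCovec (B.headLab a c (Sum.elim j₁ j₂)) ((D.tensor E).seg (CobH.tailInr t))
        (B.tailVec a c (Sum.elim j₁ j₂) (CobH.tailInr (S₁ := D.S) t)) =
      B.strandCovec (B.headLab a.snd c.snd j₂) (E.seg t) (B.tailVec a.snd c.snd j₂ t) := by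
    intro j₁ j₂ t
    exact (congrArg₂ (fun s x => B.strandCovec _ s x) (CobH.tensorSeg_inr D.seg E.seg t) rfl).trans
      (B.strandCovec_map_apply (by rintro (_ | _ | _) <;> rfl) (by cases t <;> rfl))
  constructor
  · rintro ⟨j, hj⟩
    obtain ⟨j₁, j₂, rfl⟩ : ∃ (j₁ : D.J → Fin B.n) (j₂ : E.J → Fin B.n), j = Sum.elim j₁ j₂ :=
      ⟨j ∘ Sum.inl, j ∘ Sum.inr, (Sum.elim_comp_inl_inr j).symm⟩
    exact ⟨⟨j₁, fun t => (hl j₁ j₂ t).symm.trans (hj _)⟩,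
      ⟨j₂, fun t => (hr j₁ j₂ t).symm.trans (hj _)⟩⟩
  · rintro ⟨⟨j₁, h₁⟩, ⟨j₂, h₂⟩⟩
    refine ⟨Sum.elim j₁ j₂, fun t => ?_⟩
    rcases CobH.tensor_cover t with ⟨t, rfl⟩ | ⟨t, rfl⟩
    · exact (hl j₁ j₂ t).trans (h₁ t)
    · exact (hr j₁ j₂ t).trans (h₂ t)

/-- The relation of the cylinder is `f_j(x_i) = 1` on each strand, not equality of labels, so a
permutation gives this relation after relabelling. -/
theorem rel_ofEquiv (p : X.pos ≃ Y.pos) (n : X.neg ≃ Y.neg) (a : B.Lab X) (c : B.Lab Y) :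
    B.rel (CobH.Mor.ofEquiv p n) a c ↔ B.rel (𝟙 X : X ⟶ X) a (c.1 ∘ p, c.2 ∘ n) := by
  constructor
  · rintro ⟨j, hj⟩
    refine ⟨j, ?_⟩
    rintro (x | x | ⟨⟨⟩⟩ | ⟨⟨⟩⟩)
    · exact hj (.bot x)
    · have := hj (.top (n x))
      simp only [CobH.Cut.ofEquiv, Equiv.symm_apply_apply] at this
      exact this
  · rintro ⟨j, hj⟩
    refine ⟨j, ?_⟩
    rintro (x | x | ⟨⟨⟩⟩ | ⟨⟨⟩⟩)
    · exact hj (.bot x)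
    · have := hj (.top (n.symm x))
      simp only [tailVec, Function.comp, Equiv.apply_symm_apply] at this
      exact this

/-! ### The semimodule of a `0`-manifold and the map of a cobordism -/

/-- The semimodule of a `0`-manifold: the functions on labellings that are fixed by the cylinder. -/
noncomputable def space (X : CobH A) : Submodule BoolSR (B.Lab X → BoolSR) :=
  LinearMap.eqLocus (BoolSR.relMap (B.rel (𝟙 X : X ⟶ X))) LinearMap.id

theorem relMap_comp (f : X ⟶ Y) (g : Y ⟶ Z) (v : B.Lab X → BoolSR) :
    BoolSR.relMap (B.rel g) (BoolSR.relMap (B.rel f) v) = BoolSR.relMap (B.rel (f ≫ g)) v :=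
  BoolSR.relMap_relMap (B.rel_comp f g) v

/-- Gluing a cylinder on top changes nothing, so the output is fixed by the idempotent of `Y`. -/
theorem relMap_mem_space (f : X ⟶ Y) (v : B.Lab X → BoolSR) :
    BoolSR.relMap (B.rel f) v ∈ B.space Y := by
  refine (B.relMap_comp f (𝟙 Y) v).trans ?_
  rw [Category.comp_id]
  rfl

/-- The projection onto the semimodule of a `0`-manifold. -/
noncomputable def proj (X : CobH A) : (B.Lab X → BoolSR) →ₗ[BoolSR] B.space X :=
  (BoolSR.relMap (B.rel (𝟙 X : X ⟶ X))).codRestrict _ (B.relMap_mem_space _)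

theorem proj_coe (v : B.space X) : B.proj X v = v := Subtype.ext v.2

instance projective_space (X : CobH A) : Module.Projective BoolSR (B.space X) :=
  have : Module.Projective BoolSR (B.Lab X → BoolSR) :=
    Module.Projective.of_basis (Pi.basisFun BoolSR _)
  Module.Projective.of_split (B.space X).subtype (B.proj X) (LinearMap.ext B.proj_coe)

/-- The linear map of a cobordism. -/
noncomputable def cobMap (f : X ⟶ Y) : B.space X →ₗ[BoolSR] B.space Y :=
  (BoolSR.relMap (B.rel f) ∘ₗ (B.space X).subtype).codRestrict _ fun v =>
    B.relMap_mem_space f v.1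

theorem cobMap_apply (f : X ⟶ Y) (v : B.space X) (c : B.Lab Y) :
    (B.cobMap f v).1 c = 1 ↔ ∃ a, v.1 a = 1 ∧ B.rel f a c := BoolSR.relMap_apply_eq_one

theorem space_apply (v : B.space X) (c : B.Lab X) :
    v.1 c = 1 ↔ ∃ a, v.1 a = 1 ∧ B.rel (𝟙 X : X ⟶ X) a c := by
  conv_lhs => rw [← B.proj_coe v]
  exact BoolSR.relMap_apply_eq_one

end

/-- The functor given by the state sum. -/
noncomputable def tqft : CobH A ⥤ BoolPMod where
  obj X := ⟨SemimoduleCat.of BoolSR (B.space X), B.projective_space X⟩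
  map f := ObjectProperty.homMk (SemimoduleCat.ofHom (B.cobMap f))
  map_id X := by
    refine ObjectProperty.hom_ext _ (SemimoduleCat.hom_ext (LinearMap.ext fun v => ?_))
    exact B.proj_coe v
  map_comp f g := by
    refine ObjectProperty.hom_ext _ (SemimoduleCat.hom_ext (LinearMap.ext fun v => ?_))
    exact Subtype.ext (B.relMap_comp f g v.1).symm

end DualFrame

namespace DualFrame

variable {A : Type u} {Q : BuchiQuasiAutomaton A} (B : DualFrame Q.P) {X Y Z : CobH A}

/-! ### The monoidal structure -/

/-- The idempotent of a disjoint union is the product of the idempotents; this is what makes the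
fixed spaces multiplicative. -/
theorem rel_id_union (a c : B.Lab (CobH.union X Y)) :
    B.rel (𝟙 (CobH.union X Y) : CobH.union X Y ⟶ CobH.union X Y) a c ↔
      B.rel (𝟙 X : X ⟶ X) a.fst c.fst ∧ B.rel (𝟙 Y : Y ⟶ Y) a.snd c.snd := by
  rw [← B.rel_tensor]
  have h : 𝟙 (CobH.union X Y) = CobH.Mor.tensor (𝟙 X) (𝟙 Y) := (id_tensorHom_id X Y).symm
  rw [h]

/-- The product of two vectors. -/
noncomputable def tensorVec (v : B.space X) (w : B.space Y) : B.space (CobH.union X Y) :=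
  ⟨fun c => v.1 c.fst * w.1 c.snd, by
    funext c
    refine BoolSR.ext_one ?_
    rw [BoolSR.relMap_apply_eq_one]
    simp only [LinearMap.id_apply, BoolSR.mul_eq_one, rel_id_union]
    rw [B.space_apply v, B.space_apply w]
    constructor
    · rintro ⟨a, ⟨h1, h2⟩, h3, h4⟩
      exact ⟨⟨_, h1, h3⟩, ⟨_, h2, h4⟩⟩
    · rintro ⟨⟨a, h1, h3⟩, ⟨b, h2, h4⟩⟩
      exact ⟨Lab.pair a b, ⟨h1, h2⟩, h3, h4⟩⟩

theorem tensorVec_apply (v : B.space X) (w : B.space Y) (c : B.Lab (CobH.union X Y)) :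
    (B.tensorVec v w).1 c = v.1 c.fst * w.1 c.snd := rfl

variable (X Y) in
/-- The map from the tensor product to the semimodule of a disjoint union. -/
noncomputable def mulMap : B.space X ⊗[BoolSR] B.space Y →ₗ[BoolSR] B.space (CobH.union X Y) :=
  TensorProduct.lift (LinearMap.mk₂ BoolSR B.tensorVec
    (fun v v' w => Subtype.ext (funext fun c => add_mul (v.1 c.fst) (v'.1 c.fst) (w.1 c.snd)))
    (fun r v w => Subtype.ext (funext fun c => mul_assoc r (v.1 c.fst) (w.1 c.snd)))
    (fun v w w' => Subtype.ext (funext fun c => mul_add (v.1 c.fst) (w.1 c.snd) (w'.1 c.snd)))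
    (fun r v w => Subtype.ext (funext fun c => mul_left_comm (v.1 c.fst) r (w.1 c.snd))))

theorem mulMap_tmul (v : B.space X) (w : B.space Y) :
    B.mulMap X Y (v ⊗ₜ w) = B.tensorVec v w := rfl

noncomputable instance (X : CobH A) : Fintype (B.Lab X) := Fintype.ofFinite _

open Classical in
/-- The projection of the indicator function of a labelling. -/
noncomputable def basisVec (a : B.Lab X) : B.space X := B.proj X (Pi.single a 1)

theorem basisVec_apply (a c : B.Lab X) :
    (B.basisVec a).1 c = 1 ↔ B.rel (𝟙 X : X ⟶ X) a c := by
  classical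
  refine BoolSR.relMap_apply_eq_one.trans ⟨?_, fun h => ⟨a, Pi.single_eq_same a 1, h⟩⟩
  rintro ⟨b, hb, h⟩
  by_cases hab : b = a
  · rwa [hab] at h
  · rw [Pi.single_eq_of_ne hab] at hb
    exact absurd hb BoolSR.zero_ne_one

/-- The expansion of `v` in indicator functions, projected. These vectors span and resolve the
identity but need not be independent. -/
theorem sum_basisVec (v : B.space X) : ∑ a, v.1 a • B.basisVec a = v := by
  classical
  conv_rhs => rw [← B.proj_coe v, pi_eq_sum_univ' v.1, map_sum]
  refine Finset.sum_congr rfl fun a _ => ?_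
  rw [LinearMap.map_smul]
  congr 2

variable (X Y) in
/-- The map from the semimodule of a disjoint union to the tensor product. -/
noncomputable def splitMap : B.space (CobH.union X Y) →ₗ[BoolSR] B.space X ⊗[BoolSR] B.space Y :=
  (∑ c : B.Lab (CobH.union X Y), (LinearMap.proj c).smulRight
    (B.basisVec c.fst ⊗ₜ[BoolSR] B.basisVec c.snd)) ∘ₗ (B.space (CobH.union X Y)).subtype

theorem splitMap_apply (v : B.space (CobH.union X Y)) :
    B.splitMap X Y v = ∑ c, v.1 c • (B.basisVec c.fst ⊗ₜ[BoolSR] B.basisVec c.snd) := by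
  simp [splitMap]

/-- Labellings of a disjoint union are pairs of labellings. -/
def labEquiv (X Y : CobH A) : B.Lab X × B.Lab Y ≃ B.Lab (CobH.union X Y) where
  toFun p := Lab.pair p.1 p.2
  invFun c := (c.fst, c.snd)
  left_inv _ := rfl
  right_inv c := c.pair_fst_snd

/-- Expanding both factors of a pure tensor in the spanning vectors gives the sum over pairs of
labellings that defines the splitting. -/
theorem splitMap_mulMap (t : B.space X ⊗[BoolSR] B.space Y) :
    B.splitMap X Y (B.mulMap X Y t) = t := by
  induction t with
  | zero => rw [map_zero, map_zero]
  | add s t hs ht => rw [map_add, map_add, hs, ht]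
  | tmul v w =>
    rw [mulMap_tmul, splitMap_apply, ← (B.labEquiv X Y).sum_comp, Fintype.sum_prod_type]
    conv_rhs => rw [← B.sum_basisVec v, ← B.sum_basisVec w, TensorProduct.sum_tmul]
    refine Finset.sum_congr rfl fun a _ => ?_
    rw [TensorProduct.tmul_sum]
    refine Finset.sum_congr rfl fun b _ => ?_
    rw [TensorProduct.smul_tmul_smul]
    rfl

/-- The product of the spanning vectors of the two parts is the spanning vector of the union, since
the idempotent factors. -/
theorem mulMap_splitMap (v : B.space (CobH.union X Y)) :
    B.mulMap X Y (B.splitMap X Y v) = v := by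
  rw [splitMap_apply, map_sum]
  conv_rhs => rw [← B.sum_basisVec v]
  refine Finset.sum_congr rfl fun c _ => ?_
  rw [LinearMap.map_smul, mulMap_tmul]
  congr 1
  refine Subtype.ext (funext fun b => BoolSR.ext_one ?_)
  rw [tensorVec_apply, BoolSR.mul_eq_one, basisVec_apply, basisVec_apply, basisVec_apply,
    rel_id_union]

variable (X Y) in
/-- The tensor product is the semimodule of a disjoint union. -/
noncomputable def mulEquiv : B.space X ⊗[BoolSR] B.space Y ≃ₗ[BoolSR] B.space (CobH.union X Y) :=
  { B.mulMap X Y with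
    invFun := B.splitMap X Y
    left_inv := B.splitMap_mulMap
    right_inv := B.mulMap_splitMap }

instance uniqueLabEmpty : Unique (B.Lab (CobH.empty A)) where
  default := (Empty.elim, Empty.elim)
  uniq _ := Prod.ext (funext Empty.rec) (funext Empty.rec)

/-- There are no segments, so the condition on weights is vacuous. -/
theorem rel_id_empty (a c : B.Lab (CobH.empty A)) :
    B.rel (𝟙 (CobH.empty A) : CobH.empty A ⟶ CobH.empty A) a c := by
  refine ⟨Empty.elim, ?_⟩
  rintro (⟨⟨⟩⟩ | ⟨⟨⟩⟩ | ⟨⟨⟩⟩ | ⟨⟨⟩⟩)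

/-- The semimodule of the empty `0`-manifold is the ground semiring. -/
noncomputable def unitEquiv : BoolSR ≃ₗ[BoolSR] B.space (CobH.empty A) where
  toFun r := ⟨fun _ => r, funext fun c => BoolSR.ext_one (by
    rw [BoolSR.relMap_apply_eq_one]
    exact ⟨fun ⟨_, h, _⟩ => h, fun h => ⟨c, h, B.rel_id_empty c c⟩⟩)⟩
  map_add' _ _ := rfl
  map_smul' _ _ := rfl
  invFun v := v.1 default
  left_inv _ := rfl
  right_inv v := Subtype.ext (funext fun c => congrArg v.1 (Subsingleton.elim _ c))

theorem cobMap_tensor {X' Y' : CobH A} (f : X ⟶ X') (g : Y ⟶ Y') (v : B.space X) (w : B.space Y) :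
    B.tensorVec (B.cobMap f v) (B.cobMap g w) =
      B.cobMap (X := CobH.union X Y) (Y := CobH.union X' Y') (f ⊗ₘ g) (B.tensorVec v w) := by
  refine Subtype.ext (funext fun c => BoolSR.ext_one ?_)
  rw [tensorVec_apply, BoolSR.mul_eq_one, cobMap_apply, cobMap_apply, cobMap_apply]
  constructor
  · rintro ⟨⟨a, h1, h3⟩, ⟨b, h2, h4⟩⟩
    exact ⟨Lab.pair a b, BoolSR.mul_eq_one.2 ⟨h1, h2⟩, (B.rel_tensor f g _ c).2 ⟨h3, h4⟩⟩
  · rintro ⟨a, h, h'⟩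
    obtain ⟨h1, h2⟩ := BoolSR.mul_eq_one.1 h
    obtain ⟨h3, h4⟩ := (B.rel_tensor f g _ c).1 h'
    exact ⟨⟨_, h1, h3⟩, ⟨_, h2, h4⟩⟩

theorem cobMap_id (v : B.space X) : B.cobMap (𝟙 X) v = v := B.proj_coe v

/-- A fixed vector absorbs the idempotent in `rel_ofEquiv`, leaving only the relabelling. All
structure isomorphisms of the cobordism category are of this kind. -/
theorem cobMap_ofEquiv (p : X.pos ≃ Y.pos) (n : X.neg ≃ Y.neg) (v : B.space X) (c : B.Lab Y) :
    (B.cobMap (CobH.Mor.ofEquiv p n) v).1 c = v.1 (c.1 ∘ p, c.2 ∘ n) := by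
  refine BoolSR.ext_one ?_
  rw [cobMap_apply, B.space_apply v]
  simp only [rel_ofEquiv]

/-! ### The state sum as a symmetric monoidal functor -/

/-- The isomorphism in the category of projective semimodules given by a linear equivalence. -/
def _root_.BoolPMod.isoOfEquiv {M N : BoolPMod} (e : M.obj ≃ₗ[BoolSR] N.obj) : M ≅ N :=
  ObjectProperty.isoMk _ e.toModuleIsoₛ

theorem _root_.BoolPMod.hom_ext {M N : BoolPMod} {f g : M ⟶ N}
    (h : ∀ x, BoolPMod.lin f x = BoolPMod.lin g x) : f = g :=
  ObjectProperty.hom_ext _ (SemimoduleCat.hom_ext (LinearMap.ext h))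

theorem _root_.BoolPMod.hom_ext_tensor {M N K : BoolPMod} {f g : M ⊗ N ⟶ K}
    (h : ∀ (x : M.obj) (y : N.obj), BoolPMod.lin f (x ⊗ₜ[BoolSR] y) =
      BoolPMod.lin g (x ⊗ₜ[BoolSR] y)) : f = g :=
  ObjectProperty.hom_ext _ (SemimoduleCat.hom_ext (TensorProduct.ext' h))

theorem _root_.BoolPMod.hom_ext_tensor₃ {M N K L : BoolPMod} {f g : (M ⊗ N) ⊗ K ⟶ L}
    (h : ∀ (x : M.obj) (y : N.obj) (z : K.obj),
      BoolPMod.lin f ((x ⊗ₜ[BoolSR] y) ⊗ₜ[BoolSR] z) =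
      BoolPMod.lin g ((x ⊗ₜ[BoolSR] y) ⊗ₜ[BoolSR] z)) : f = g :=
  ObjectProperty.hom_ext _ (SemimoduleCat.hom_ext (TensorProduct.ext_threefold h))

/-- The monoidal structure of the state sum functor. -/
noncomputable def tqftCoreMonoidal : B.tqft.CoreMonoidal where
  εIso := BoolPMod.isoOfEquiv (M := 𝟙_ BoolPMod) B.unitEquiv
  μIso X Y := BoolPMod.isoOfEquiv (M := B.tqft.obj X ⊗ B.tqft.obj Y) (N := B.tqft.obj (X ⊗ Y))
    (B.mulEquiv X Y)
  μIso_hom_natural_left {X X'} f Y := by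
    refine BoolPMod.hom_ext_tensor fun (v : B.space X) (w : B.space Y) => ?_
    have h := B.cobMap_tensor f (𝟙 Y) v w
    rw [cobMap_id] at h
    exact h
  μIso_hom_natural_right {Y Y'} X f := by
    refine BoolPMod.hom_ext_tensor fun (v : B.space X) (w : B.space Y) => ?_
    have h := B.cobMap_tensor (𝟙 X) f v w
    rw [cobMap_id] at h
    exact h
  associativity X Y Z := by
    refine BoolPMod.hom_ext_tensor₃ fun (v : B.space X) (w : B.space Y) (z : B.space Z) => ?_
    refine Subtype.ext (funext fun c => ?_)
    refine (B.cobMap_ofEquiv (X := CobH.union (CobH.union X Y) Z) _ _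
      (B.tensorVec (B.tensorVec v w) z) c).trans ?_
    -- On a labelling of the three parts the associator only regroups labels, so the axiom is
    -- associativity in `𝔹`.
    exact mul_assoc (v.1 c.fst) (w.1 (Lab.fst c.snd)) (z.1 (Lab.snd c.snd))
  left_unitality X := by
    refine BoolPMod.hom_ext_tensor fun (r : BoolSR) (v : B.space X) => ?_
    refine Subtype.ext (funext fun c => ?_)
    refine Eq.trans ?_ (B.cobMap_ofEquiv (X := CobH.union (CobH.empty A) X) _ _
      (B.tensorVec (B.unitEquiv r) v) c).symm
    rfl
  right_unitality X := by
    refine BoolPMod.hom_ext_tensor fun (v : B.space X) (r : BoolSR) => ?_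
    refine Subtype.ext (funext fun c => ?_)
    refine Eq.trans ?_ (B.cobMap_ofEquiv (X := CobH.union X (CobH.empty A)) _ _
      (B.tensorVec v (B.unitEquiv r)) c).symm
    exact mul_comm r (v.1 c)

noncomputable instance : B.tqft.Monoidal := B.tqftCoreMonoidal.toMonoidal

noncomputable instance : B.tqft.Braided where
  braided X Y := by
    refine BoolPMod.hom_ext_tensor fun (v : B.space X) (w : B.space Y) => ?_
    refine Subtype.ext (funext fun c => ?_)
    refine (B.cobMap_ofEquiv (X := CobH.union X Y) _ _ (B.tensorVec v w) c).trans ?_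
    exact mul_comm (v.1 c.snd) (w.1 c.fst)

/-! ### The values on elementary cobordisms -/

/-- The labelling of a positive point. -/
def labPlus (i : Fin B.n) : B.Lab (CobH.plus A) := (fun _ => i, Empty.elim)

/-- The labelling of a negative point. -/
def labMinus (i : Fin B.n) : B.Lab (CobH.minus A) := (Empty.elim, fun _ => i)

theorem labPlus_surjective (a : B.Lab (CobH.plus A)) : a = B.labPlus (a.1 ()) :=
  Prod.ext rfl (funext Empty.rec)

theorem labMinus_surjective (a : B.Lab (CobH.minus A)) : a = B.labMinus (a.2 ()) :=
  Prod.ext (funext Empty.rec) rfl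

theorem exists_labPlus {p : B.Lab (CobH.plus A) → Prop} : (∃ a, p a) ↔ ∃ i, p (B.labPlus i) :=
  ⟨fun ⟨a, h⟩ => ⟨a.1 (), by rwa [← labPlus_surjective]⟩, fun ⟨_, h⟩ => ⟨_, h⟩⟩

theorem exists_labMinus {p : B.Lab (CobH.minus A) → Prop} : (∃ a, p a) ↔ ∃ i, p (B.labMinus i) :=
  ⟨fun ⟨a, h⟩ => ⟨a.2 (), by rwa [← labMinus_surjective]⟩, fun ⟨_, h⟩ => ⟨_, h⟩⟩

theorem rel_strand (w : List A) (i j : Fin B.n) :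
    B.rel (CobH.strand w) (B.labPlus i) (B.labPlus j) ↔ B.covec j (Q.act w (B.vec i)) = 1 := by
  constructor
  · rintro ⟨_, h⟩
    exact h (.bot ())
  · intro h
    refine ⟨Empty.elim, ?_⟩
    rintro (⟨⟩ | ⟨⟨⟩⟩ | ⟨⟨⟩⟩ | ⟨⟨⟩⟩)
    exact h

theorem rel_id_plus (i j : Fin B.n) :
    B.rel (𝟙 (CobH.plus A) : CobH.plus A ⟶ CobH.plus A) (B.labPlus i) (B.labPlus j) ↔
      B.covec j (B.vec i) = 1 := by
  constructor
  · rintro ⟨_, h⟩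
    exact h (.bot ())
  · intro h
    refine ⟨Empty.elim, ?_⟩
    rintro (⟨⟩ | ⟨⟨⟩⟩ | ⟨⟨⟩⟩ | ⟨⟨⟩⟩)
    exact h

/-- Over a negative point the segment runs from the top to the bottom, hence the matrix transposed
to that of `rel_id_plus`. -/
theorem rel_id_minus (i j : Fin B.n) :
    B.rel (𝟙 (CobH.minus A) : CobH.minus A ⟶ CobH.minus A) (B.labMinus i) (B.labMinus j) ↔
      B.covec i (B.vec j) = 1 := by
  constructor
  · rintro ⟨_, h⟩
    exact h (.top ())
  · intro h
    refine ⟨Empty.elim, ?_⟩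
    rintro (⟨⟨⟩⟩ | ⟨⟩ | ⟨⟨⟩⟩ | ⟨⟨⟩⟩)
    exact h

theorem rel_halfIn (w : List A) (a : B.Lab (CobH.empty A)) (i : Fin B.n) :
    B.rel (CobH.halfIn w) a (B.labPlus i) ↔ B.covec i (Q.act w Q.init) = 1 := by
  constructor
  · rintro ⟨_, h⟩
    exact h (.inner ())
  · intro h
    refine ⟨Empty.elim, ?_⟩
    rintro (⟨⟨⟩⟩ | ⟨⟨⟩⟩ | ⟨⟨⟩⟩ | ⟨⟩)
    exact h

theorem rel_halfOut (ω : Stream' A) (i : Fin B.n) (c : B.Lab (CobH.empty A)) :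
    B.rel (CobH.halfOut ω) (B.labPlus i) c ↔ Q.acceptCovec ω (B.vec i) = 1 := by
  constructor
  · rintro ⟨_, h⟩
    exact h (.bot ())
  · intro h
    refine ⟨Empty.elim, ?_⟩
    rintro (⟨⟩ | ⟨⟨⟩⟩ | ⟨⟨⟩⟩ | ⟨⟨⟩⟩)
    exact h

theorem rel_cap (i j : Fin B.n) (c : B.Lab (CobH.empty A)) :
    B.rel (CobH.cap A) (Lab.pair (B.labMinus i) (B.labPlus j)) c ↔ B.covec i (B.vec j) = 1 := by
  constructor
  · rintro ⟨_, h⟩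
    exact h (.bot (.inr ()))
  · intro h
    refine ⟨Empty.elim, ?_⟩
    rintro ((⟨⟨⟩⟩ | ⟨⟩) | ⟨⟨⟩⟩ | ⟨⟨⟩⟩ | ⟨⟨⟩⟩)
    exact h

theorem rel_cup (a : B.Lab (CobH.empty A)) (i j : Fin B.n) :
    B.rel (CobH.cup A) a (Lab.pair (B.labPlus i) (B.labMinus j)) ↔ B.covec i (B.vec j) = 1 := by
  constructor
  · rintro ⟨_, h⟩
    exact h (.top (.inr ()))
  · intro h
    refine ⟨Empty.elim, ?_⟩
    rintro (⟨⟨⟩⟩ | (⟨⟨⟩⟩ | ⟨⟩) | ⟨⟨⟩⟩ | ⟨⟨⟩⟩)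
    exact h

theorem rel_interval (ω : Stream' A) (a c : B.Lab (CobH.empty A)) :
    B.rel (CobH.interval ω) a c ↔ Q.acceptCovec ω Q.init = 1 := by
  constructor
  · rintro ⟨_, h⟩
    exact h (.inner ())
  · intro h
    refine ⟨Empty.elim, ?_⟩
    rintro (⟨⟨⟩⟩ | ⟨⟨⟩⟩ | ⟨⟨⟩⟩ | ⟨⟩)
    exact h

/-- The existential is the sum over the label of the single cut point, that is, the trace in the
frame. -/
theorem rel_circle (w : List A) (a c : B.Lab (CobH.empty A)) :
    B.rel (CobH.circle w) a c ↔ ∃ i, B.covec i (Q.act w (B.vec i)) = 1 := by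
  constructor
  · rintro ⟨j, h⟩
    exact ⟨j (), h (.cut ())⟩
  · rintro ⟨i, h⟩
    refine ⟨fun _ => i, ?_⟩
    rintro (⟨⟨⟩⟩ | ⟨⟨⟩⟩ | ⟨⟩ | ⟨⟨⟩⟩)
    exact h

/-! ### The semimodules of the positive and the negative point -/

theorem space_plus_apply (v : B.space (CobH.plus A)) (i : Fin B.n) :
    v.1 (B.labPlus i) = ∑ j, v.1 (B.labPlus j) * B.covec i (B.vec j) := by
  refine BoolSR.ext_one ?_
  rw [space_apply, exists_labPlus]
  simp [rel_id_plus]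

theorem space_minus_apply (v : B.space (CobH.minus A)) (i : Fin B.n) :
    v.1 (B.labMinus i) = ∑ j, v.1 (B.labMinus j) * B.covec j (B.vec i) := by
  refine BoolSR.ext_one ?_
  rw [space_apply, exists_labMinus]
  simp [rel_id_minus]

/-- The semimodule of a positive point is that of the automaton. -/
noncomputable def plusEquiv : B.space (CobH.plus A) ≃ₗ[BoolSR] Q.P where
  toFun v := ∑ i, v.1 (B.labPlus i) • B.vec i
  map_add' v w := by simp [add_smul, Finset.sum_add_distrib]
  map_smul' r v := by simp [mul_smul, Finset.smul_sum]
  invFun x := ⟨fun a => B.covec (a.1 ()) x, by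
    funext a
    refine BoolSR.ext_one ?_
    rw [BoolSR.relMap_apply_eq_one, exists_labPlus, B.labPlus_surjective a]
    simp only [rel_id_plus]
    exact (B.apply_eq_one (B.covec (a.1 ())) x).symm⟩
  left_inv v := by
    refine Subtype.ext (funext fun a => ?_)
    rw [B.labPlus_surjective a]
    conv_rhs => rw [space_plus_apply]
    simp [labPlus]
  right_inv x := B.sum_smul x

theorem plusEquiv_apply (v : B.space (CobH.plus A)) :
    B.plusEquiv v = ∑ i, v.1 (B.labPlus i) • B.vec i := rfl

/-- Pairing `∑ v_j x_j` with `f_i` applies the idempotent to `v`, which leaves it unchanged. -/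
theorem covec_plusEquiv (i : Fin B.n) (v : B.space (CobH.plus A)) :
    B.covec i (B.plusEquiv v) = v.1 (B.labPlus i) := by
  rw [space_plus_apply, plusEquiv_apply]
  simp

theorem apply_plusEquiv_eq_one (ξ : Q.P →ₗ[BoolSR] BoolSR) (v : B.space (CobH.plus A)) :
    ξ (B.plusEquiv v) = 1 ↔ ∃ i, v.1 (B.labPlus i) = 1 ∧ ξ (B.vec i) = 1 := by
  rw [plusEquiv_apply]
  simp

/-- The semimodule of a negative point is the dual of that of the automaton. -/
noncomputable def minusEquiv : B.space (CobH.minus A) ≃ₗ[BoolSR] Module.Dual BoolSR Q.P where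
  toFun v := ∑ i, v.1 (B.labMinus i) • B.covec i
  map_add' v w := by simp [add_smul, Finset.sum_add_distrib]
  map_smul' r v := by simp [mul_smul, Finset.smul_sum]
  invFun ξ := ⟨fun a => ξ (B.vec (a.2 ())), by
    funext a
    refine BoolSR.ext_one ?_
    rw [BoolSR.relMap_apply_eq_one, exists_labMinus, B.labMinus_surjective a]
    simp only [rel_id_minus]
    -- The function `i ↦ ξ(x_i)` is fixed by the transposed idempotent because `∑ f_j(x_i) ξ(x_j) =
    -- ξ(x_i)`.
    exact (exists_congr fun _ => and_comm).trans (B.apply_eq_one ξ (B.vec (a.2 ()))).symm⟩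
  left_inv v := by
    refine Subtype.ext (funext fun a => ?_)
    rw [B.labMinus_surjective a]
    conv_rhs => rw [space_minus_apply]
    simp [labMinus]
  right_inv ξ := by
    refine LinearMap.ext fun x => ?_
    rw [← B.sum_mul ξ x]
    simp [labMinus, mul_comm]

theorem minusEquiv_apply_eq_one (v : B.space (CobH.minus A)) (x : Q.P) :
    B.minusEquiv v x = 1 ↔ ∃ i, v.1 (B.labMinus i) = 1 ∧ B.covec i x = 1 := by
  change (∑ i, v.1 (B.labMinus i) • B.covec i) x = 1 ↔ _
  simp

/-! ### Evaluation of the elementary cobordisms -/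

theorem plusEquiv_strand (w : List A) (v : B.space (CobH.plus A)) :
    B.plusEquiv (B.cobMap (CobH.strand w) v) = Q.act w (B.plusEquiv v) := by
  refine B.ext_covec fun i => BoolSR.ext_one ?_
  rw [covec_plusEquiv, cobMap_apply, exists_labPlus]
  simp only [rel_strand]
  exact (B.apply_plusEquiv_eq_one (B.covec i ∘ₗ Q.act w) v).symm

theorem plusEquiv_halfIn (w : List A) :
    B.plusEquiv (B.cobMap (CobH.halfIn w) (B.unitEquiv 1)) = Q.act w Q.init := by
  refine B.ext_covec fun i => BoolSR.ext_one ?_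
  rw [covec_plusEquiv]
  refine (B.cobMap_apply _ _ _).trans ?_
  simp only [rel_halfIn]
  exact ⟨fun ⟨_, _, h⟩ => h, fun h => ⟨(default : B.Lab (CobH.empty A)), rfl, h⟩⟩

theorem halfOut_eq_one (ω : Stream' A) (v : B.space (CobH.plus A)) :
    B.unitEquiv.symm (B.cobMap (CobH.halfOut ω) v) = 1 ↔ Q.AcceptsFrom (B.plusEquiv v) ω := by
  refine (B.cobMap_apply _ _ _).trans ?_
  rw [exists_labPlus, ← Q.acceptCovec_eq_one, B.apply_plusEquiv_eq_one]
  simp only [rel_halfOut]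

/-- The state sum is `∑ v_i w_j f_i(x_j)`. As `w` is fixed, the sum over `j` collapses to `w_i`,
which is `f_i` of the vector of `P` given by `w`. -/
theorem cap_tensorVec (v : B.space (CobH.minus A)) (w : B.space (CobH.plus A)) :
    B.unitEquiv.symm (B.cobMap (CobH.cap A) (B.tensorVec v w)) =
      B.minusEquiv v (B.plusEquiv w) := by
  refine BoolSR.ext_one ?_
  refine (B.cobMap_apply _ _ _).trans ?_
  rw [minusEquiv_apply_eq_one]
  simp only [covec_plusEquiv]
  constructor
  · rintro ⟨a, h, h'⟩
    obtain ⟨h1, h2⟩ := BoolSR.mul_eq_one.1 h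
    rw [B.labMinus_surjective a.fst] at h1
    rw [B.labPlus_surjective a.snd] at h2
    rw [← a.pair_fst_snd, B.labMinus_surjective a.fst, B.labPlus_surjective a.snd, rel_cap] at h'
    refine ⟨_, h1, ?_⟩
    rw [space_plus_apply]
    simp only [BoolSR.sum_eq_one, BoolSR.mul_eq_one]
    exact ⟨_, Finset.mem_univ _, h2, h'⟩
  · rintro ⟨i, h1, h2⟩
    rw [space_plus_apply] at h2
    simp only [BoolSR.sum_eq_one, BoolSR.mul_eq_one] at h2
    obtain ⟨j, -, h2, h3⟩ := h2
    exact ⟨Lab.pair (B.labMinus i) (B.labPlus j), BoolSR.mul_eq_one.2 ⟨h1, h2⟩,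
      (B.rel_cap i j _).2 h3⟩

/-- At the labels `(i, j)` the cup has the value `f_i(x_j)`, and the right side has `∑ f_i(x_k)
f_k(x_j)`. They agree by resolving `x_j`. -/
theorem splitMap_cup :
    B.splitMap _ _ (B.cobMap (CobH.cup A) (B.unitEquiv 1)) =
      ∑ k, B.plusEquiv.symm (B.vec k) ⊗ₜ[BoolSR] B.minusEquiv.symm (B.covec k) := by
  -- The comparison is moved to functions on labellings of the union, where it can be made
  -- pointwise.
  rw [← B.splitMap_mulMap (∑ k, _), map_sum]
  congr 1
  refine Subtype.ext (funext fun c => BoolSR.ext_one ?_)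
  refine (B.cobMap_apply _ _ _).trans ?_
  rw [← c.pair_fst_snd, B.labPlus_surjective c.fst, B.labMinus_surjective c.snd]
  simp only [rel_cup, mulMap_tmul]
  refine Iff.trans ⟨fun ⟨_, _, h⟩ => h, fun h => ⟨(default : B.Lab (CobH.empty A)), rfl, h⟩⟩
    ((B.apply_eq_one _ _).trans ?_)
  rw [AddSubmonoidClass.coe_finsetSum, Finset.sum_apply]
  simp only [BoolSR.sum_eq_one, Finset.mem_univ, true_and, tensorVec_apply, BoolSR.mul_eq_one]
  exact exists_congr fun _ => and_comm

/-- The tensor `∑ x_k ⊗ f_k` acts by `x ↦ ∑ f_k(x) x_k`, and this is the resolution of the identity.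
-/
theorem dualTensorHom_cup :
    dualTensorHom BoolSR Q.P Q.P (TensorProduct.comm BoolSR Q.P (Module.Dual BoolSR Q.P)
      (TensorProduct.congr B.plusEquiv B.minusEquiv
        (B.splitMap _ _ (B.cobMap (CobH.cup A) (B.unitEquiv 1))))) = LinearMap.id := by
  refine LinearMap.ext fun x => ?_
  rw [splitMap_cup]
  conv_rhs => rw [LinearMap.id_apply, ← B.sum_smul x]
  simp only [map_sum, TensorProduct.congr_tmul, LinearEquiv.apply_symm_apply,
    TensorProduct.comm_tmul, LinearMap.sum_apply, dualTensorHom_apply]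

theorem interval_eq_one (ω : Stream' A) :
    B.unitEquiv.symm (B.cobMap (CobH.interval ω) (B.unitEquiv 1)) = 1 ↔ ω ∈ Q.language := by
  refine (B.cobMap_apply _ _ _).trans ?_
  simp only [rel_interval, Q.acceptCovec_eq_one]
  exact ⟨fun ⟨_, _, h⟩ => h, fun h => ⟨(default : B.Lab (CobH.empty A)), rfl, h⟩⟩

theorem circle_eq (w : List A) (t : Module.Dual BoolSR Q.P ⊗[BoolSR] Q.P)
    (ht : dualTensorHom BoolSR Q.P Q.P t = Q.act w) :
    B.unitEquiv.symm (B.cobMap (CobH.circle w) (B.unitEquiv 1)) = contractLeft BoolSR Q.P t := by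
  rw [← B.sum_dualTensorHom, ht]
  refine BoolSR.ext_one ((B.cobMap_apply _ _ _).trans ?_)
  simp only [rel_circle, BoolSR.sum_eq_one, Finset.mem_univ, true_and]
  exact ⟨fun ⟨_, _, h⟩ => h, fun h => ⟨(default : B.Lab (CobH.empty A)), rfl, h⟩⟩

end DualFrame

/-! ### The theorem -/

theorem mainTheorem6 {A : Type u} (Q : BuchiQuasiAutomaton A) :
    ∃ (F : CobH A ⥤ BoolPMod) (_ : F.Braided)
      (φ : (F.obj (CobH.plus A)).obj ≃ₗ[BoolSR] Q.P)
      (ψ : (F.obj (CobH.minus A)).obj ≃ₗ[BoolSR] Module.Dual BoolSR Q.P),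
      (∀ (w : List A) x, φ (BoolPMod.lin (F.map (CobH.strand w)) x) = Q.act w (φ x)) ∧
      (∀ w : List A, φ (tqftVec F (CobH.halfIn w)) = Q.act w Q.init) ∧
      (∀ (ω : Stream' A) x, tqftCovec F (CobH.halfOut ω) x = 1 ↔ Q.AcceptsFrom (φ x) ω) ∧
      (∀ f x, tqftCovec F (CobH.cap A) (tqftTensor F f x) = ψ f (φ x)) ∧
      dualTensorHom BoolSR Q.P Q.P (TensorProduct.comm BoolSR Q.P (Module.Dual BoolSR Q.P)
        (TensorProduct.congr φ ψ (tqftSplit F (tqftVec F (CobH.cup A))))) = LinearMap.id ∧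
      (∀ ω : Stream' A, tqftEval F (CobH.interval ω) = 1 ↔ ω ∈ Q.language) ∧
      (∀ (w : List A) (t : Module.Dual BoolSR Q.P ⊗[BoolSR] Q.P),
        dualTensorHom BoolSR Q.P Q.P t = Q.act w →
          tqftEval F (CobH.circle w) = contractLeft BoolSR Q.P t) := by
  -- Finite generation and projectivity of `P` enter only through the existence of a frame.
  obtain ⟨B⟩ := DualFrame.exists_of_projective (P := Q.P)
  -- A closed cobordism is evaluated on the vector of the empty cobordism, which is the unit because
  -- the cylinder fixes it.
  have hunit : tqftVec B.tqft (𝟙 (𝟙_ (CobH A))) = B.unitEquiv 1 := B.cobMap_id (B.unitEquiv 1)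
  refine ⟨B.tqft, inferInstance, B.plusEquiv, B.minusEquiv, B.plusEquiv_strand,
    B.plusEquiv_halfIn, B.halfOut_eq_one, B.cap_tensorVec, B.dualTensorHom_cup, fun ω => ?_, fun w t ht => ?_⟩
  · unfold tqftEval
    rw [hunit]
    exact B.interval_eq_one ω
  · unfold tqftEval
    rw [hunit]
    exact B.circle_eq w t ht
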